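/- **Setting.** Let $z_b\in\mathbb R^n$, let $B^\infty\in\mathbb R^{n\times n}$ and $R\in\mathbb R^{d\times d}$ be symmetric positive definite, $y\in\mathbb R^d$, and let $\mathcal H:\mathbb R^n\to\mathbb R^d$ be continuously differentiable. Write $\|v\|_A^2=v^\top A v$, and $\|\cdot\|$ for the Euclidean norm. For a prior covariance $C$ put $$\phi_C(x)=\tfrac12\|x-z_b\|^2_{C^{-1}}+\tfrac12\|y-\mathcal H(x)\|^2_{R^{-1}},\qquad f=\phi_{B^\infty}.$$ Consider a random run of the following Levenberg–Marquardt algorithm, with constants $\eta_1\in(0,1)$, $\eta_2,\mu_{\min}>0$, $\lambda>1$, $\mu_0\ge\mu_{\min}$, $\mu_{\max}\in\mathbb R$, started at a fixed $x_0$ with parameter $\mu_0$ and stopped as soon as the parameter exceeds $\mu_{\max}$. At iteration $i$, with iterate $X_i$ and parameter $\mathcal u_i$, there is an ensemble $\hat z^1,\dots,\hat z^N$ of independent draws from the Gaussian law $N(z_b,B^\infty)$, with empirical covariance $$B^N=\frac1{N-1}\sum_{k=1}^N(\hat z^k-z_b)(\hat z^k-z_b)^\top .$$ The model is $$m_i(s)=\tfrac12\|s+X_i-z_b\|^2_{(B^N)^{-1}}+\tfrac12\|y-\mathcal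 H(X_i)-\mathcal H'(X_i)s\|^2_{R^{-1}}+\tfrac12\gamma_i\|s\|^2,\qquad \gamma_i=\mathcal u_i\|\nabla m_i(0)\|,$$ $S_i$ is a trial step, and the estimates of $f(X_i)$ and $f(X_i+S_i)$ are $F^0_i=\phi_{B^N}(X_i)$ and $F^1_i=\phi_{B^N}(X_i+S_i)$. If $(F^0_i-F^1_i)/(m_i(0)-m_i(S_i))\ge\eta_1$ and $\|\nabla m_i(0)\|\ge\eta_2/\mathcal u_i$, then $X_{i+1}=X_i+S_i$ and $\mathcal u_{i+1}=\max\{\mathcal u_i/\lambda,\mu_{\min}\}$; otherwise $X_{i+1}=X_i$ and $\mathcal u_{i+1}=\lambda\mathcal u_i$. Fix an iteration $j$, and let $B^N$ denote the empirical covariance of that iteration. Let $\mathcal F$ be a $\sigma$-algebra of events that contains the history of the run (i.e. $X_i,\mathcal u_i$ for $i\le j$ and $S_i,F^0_i,F^1_i,m_i$ for $i<j$ are $\mathcal F$-measurable) and is independent of the ensemble of iteration $j$, so that given $\mathcal F$ the randomness comes only from $B^N$. For a fixed $x\in\mathbb R^n$ let $$\mathcal V(x)=\operatorname{Var}\big(\|x-z_b\|^2_{(B^N)^{-1}}\big)\in[0,\infty],$$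 and let $\lambda_{\max}(x)\in[0,\infty]$ be the largest eigenvalue of $\operatorname{Cov}\big((B^N)^{-1}(x-z_b)\big)$ ($\infty$ if second moments are infinite). **Theorem 6.2.** Let $\varepsilon_f,\kappa_{ef},\kappa_{eg}>0$, $\bar\mu_j=\min\{\lambda^j\mu_0,\mu_{\max}\}$ and $$\aleph_j=\max\left\{\frac{\|X_j-z_b\|^2_{(B^\infty)^{-1}}}{2\varepsilon_f},\ \frac{\|X_j+S_j-z_b\|^2_{(B^\infty)^{-1}}}{2\varepsilon_f},\ \frac{\|X_j-z_b\|^2_{(B^\infty)^{-1}}}{2\kappa_{ef}},\ \frac{\|(B^\infty)^{-1}(X_j-z_b)\|}{\kappa_{eg}\,\bar\mu_j}\right\}.$$ Almost surely, whenever the run has not been stopped by iteration $j$ (it suffices that $\mathcal u_j\le\mu_{\max}$) and $$N>(\aleph_j\,\bar\mu_j^2+1)\,n+1,$$ the following bounds hold, the second one under the additional assumption that $S_j$ is $\mathcal F$-measurable: $$\Pr\Big\{|f(X_j)-F^0_j|\le\tfrac{\varepsilon_f}{\mathcal u_j^2}\,\Big|\,\mathcal F\Big\}\ge1-\frac{\mathcal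 V(X_j)}{\Theta_j^2},\qquad \Theta_j=\frac{2\varepsilon_f}{\bar\mu_j^2}-\frac{n}{N-1-n}\|X_j-z_b\|^2_{(B^\infty)^{-1}};$$ $$\Pr\Big\{|f(X_j+S_j)-F^1_j|\le\tfrac{\varepsilon_f}{\mathcal u_j^2}\,\Big|\,\mathcal F\Big\}\ge1-\frac{\mathcal V(X_j+S_j)}{\tilde\Theta_j^2},\qquad \tilde\Theta_j=\frac{2\varepsilon_f}{\bar\mu_j^2}-\frac{n}{N-1-n}\|X_j+S_j-z_b\|^2_{(B^\infty)^{-1}};$$ $$\Pr\Big\{|f(X_j)-m_j(0)|\le\tfrac{\kappa_{ef}}{\mathcal u_j^2}\,\Big|\,\mathcal F\Big\}\ge1-\frac{\mathcal V(X_j)}{\Upsilon_j^2},\qquad \Upsilon_j=\frac{2\kappa_{ef}}{\bar\mu_j^2}-\frac{n}{N-1-n}\|X_j-z_b\|^2_{(B^\infty)^{-1}};$$ $$\Pr\Big\{\|\nabla f(X_j)-\nabla m_j(0)\|\le\tfrac{\kappa_{eg}}{\mathcal u_j}\,\Big|\,\mathcal F\Big\}\ge1-\frac{n\,\lambda_{\max}(X_j)}{\tilde\Upsilon_j^2},\qquad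 \tilde\Upsilon_j=\frac{\kappa_{eg}}{\bar\mu_j}-\frac{n}{N-1-n}\|(B^\infty)^{-1}(X_j-z_b)\|.$$ (A bound whose variance or eigenvalue is infinite is vacuous.) -/

import Mathlib

open MeasureTheory ProbabilityTheory
open scoped ENNReal

noncomputable section

namespace DataAssim

/-- `ℝⁿ` with the Euclidean norm. -/
abbrev E (n : ℕ) : Type := EuclideanSpace ℝ (Fin n)

/-- Matrix-vector product `A v` on Euclidean space. -/
def matVec {n : ℕ} (A : Matrix (Fin n) (Fin n) ℝ) (v : E n) : E n :=
  WithLp.toLp 2 (A.mulVec v.ofLp)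

/-- The weighted square norm `‖v‖²_A = vᵀ A v`. -/
def wnormSq {n : ℕ} (A : Matrix (Fin n) (Fin n) ℝ) (v : E n) : ℝ :=
  v.ofLp ⬝ᵥ A.mulVec v.ofLp

/-- The data of the (strong constraint) 4DVAR problem, in the reduced form in which the only
unknown is the initial state: prior mean `zb` and prior covariance `Binf`, the stacked observation
vector `y` with noise covariance `R`, and the stacked (model composed with observation)
operator `H`. -/
structure Problem (n d : ℕ) where
  zb : E n
  Binf : Matrix (Fin n) (Fin n) ℝ
  Binf_posDef : Binf.PosDef
  y : E d
  R : Matrix (Fin d) (Fin d) ℝ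
  R_posDef : R.PosDef
  H : E n → E d
  H_contDiff : ContDiff ℝ 1 H

namespace Problem

variable {n d : ℕ} (D : Problem n d)

/-- The cost `½ ‖x - z_b‖²_{C⁻¹} + ½ ‖y - H(x)‖²_{R⁻¹}` with prior covariance `C`. -/
def cost (C : Matrix (Fin n) (Fin n) ℝ) (x : E n) : ℝ :=
  1 / 2 * wnormSq C⁻¹ (x - D.zb) + 1 / 2 * wnormSq D.R⁻¹ (D.y - D.H x)

/-- The exact objective function: the cost with the true covariance. -/
def f (x : E n) : ℝ := D.cost D.Binf x

/-- The regularized Gauss-Newton model at `x`, as a function of the step `s`: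
`½ ‖s + x - z_b‖²_{C⁻¹} + ½ ‖y - H(x) - H'(x) s‖²_{R⁻¹} + ½ γ ‖s‖²`. -/
def model (C : Matrix (Fin n) (Fin n) ℝ) (γ : ℝ) (x s : E n) : ℝ :=
  1 / 2 * wnormSq C⁻¹ (s + x - D.zb)
    + 1 / 2 * wnormSq D.R⁻¹ (D.y - D.H x - fderiv ℝ D.H x s) + 1 / 2 * γ * ‖s‖ ^ 2

/-- The gradient of the model at the step `0`.  It does not depend on the
regularization parameter `γ` (see `gradient_model_zero`), so it is taken with `γ = 0`. -/
def modelGrad (C : Matrix (Fin n) (Fin n) ℝ) (x : E n) : E n :=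
  gradient (D.model C 0 x) 0

theorem gradient_model_zero (C : Matrix (Fin n) (Fin n) ℝ) (γ : ℝ) (x : E n) :
    gradient (D.model C γ x) 0 = D.modelGrad C x := by
  have hq : HasFDerivAt (fun s : E n => 1 / 2 * γ * ‖s‖ ^ 2) (0 : E n →L[ℝ] ℝ) 0 := by
    have h := ((hasStrictFDerivAt_norm_sq (0 : E n)).hasFDerivAt).const_mul (1 / 2 * γ)
    have h0 : (1 / 2 * γ) • (2 • (innerSL ℝ) (0 : E n)) = (0 : E n →L[ℝ] ℝ) := by
      rw [map_zero, smul_zero, smul_zero]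
    exact h0 ▸ h
  have hd : DifferentiableAt ℝ (D.model C 0 x) 0 := by
    unfold Problem.model wnormSq dotProduct Matrix.mulVec dotProduct
    simp only [mul_zero, zero_mul, add_zero]
    fun_prop
  have hE : D.model C γ x = D.model C 0 x + fun s : E n => 1 / 2 * γ * ‖s‖ ^ 2 := by
    funext s
    simp [Problem.model]
  unfold Problem.modelGrad gradient
  rw [hE, (hd.hasFDerivAt.add hq).fderiv, add_zero]

end Problem

/-- The constants of the Levenberg-Marquardt algorithm; the run is stopped as soon as the
regularization parameter exceeds `muMax`. -/
structure Params where
  eta1 : ℝ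
  eta2 : ℝ
  muMin : ℝ
  lam : ℝ
  mu0 : ℝ
  muMax : ℝ
  eta1_pos : 0 < eta1
  eta1_lt_one : eta1 < 1
  eta2_pos : 0 < eta2
  muMin_pos : 0 < muMin
  one_lt_lam : 1 < lam
  muMin_le_mu0 : muMin ≤ mu0

/-- The empirical covariance `1/(N-1) ∑ₖ (zᵏ - z_b)(zᵏ - z_b)ᵀ` of an ensemble. -/
def empCov {n N : ℕ} (zb : E n) (z : Fin N → E n) : Matrix (Fin n) (Fin n) ℝ :=
  ((N : ℝ) - 1)⁻¹ • ∑ k, Matrix.vecMulVec (z k - zb).ofLp (z k - zb).ofLp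

/-- A random run of the Levenberg-Marquardt algorithm on the data assimilation problem `D`.
At iteration `i` the iterate is `X i`, the regularization parameter `u i`, the trial step `S i`,
and the prior covariance is replaced by the empirical covariance of the ensemble `z i` of `N`
independent draws from `N(z_b, B^∞)`.  How the trial step is computed, and how the ensembles
of different iterations are related, is left free. -/
structure Run {n d : ℕ} (D : Problem n d) (c : Params) (N : ℕ) {Ω : Type*} [MeasurableSpace Ω]
    (P : Measure Ω) where
  X : ℕ → Ω → E n
  u : ℕ → Ω → ℝ
  S : ℕ → Ω → E n
  z : ℕ → Fin N → Ω → E n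
  x0 : E n
  z_measurable : ∀ i k, Measurable (z i k)
  z_law : ∀ i k, P.map (z i k) = multivariateGaussian D.zb D.Binf
  z_indep : ∀ i, iIndepFun (z i) P
  X_zero : ∀ ω, X 0 ω = x0
  u_zero : ∀ ω, u 0 ω = c.mu0
  /-- Successful iterations: the ratio of estimated decrease to model decrease is at least `η₁`
  and the model gradient has norm at least `η₂ / μ`. -/
  success : ∀ i ω,
    let C := empCov D.zb (fun k => z i k ω)
    let g := D.modelGrad C (X i ω)
    let m := D.model C (u i ω * ‖g‖) (X i ω)
    c.eta1 ≤ (D.cost C (X i ω) - D.cost C (X i ω + S i ω)) / (m 0 - m (S i ω)) ∧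
        c.eta2 / u i ω ≤ ‖g‖ →
      X (i + 1) ω = X i ω + S i ω ∧ u (i + 1) ω = max (u i ω / c.lam) c.muMin
  /-- All other iterations. -/
  failure : ∀ i ω,
    let C := empCov D.zb (fun k => z i k ω)
    let g := D.modelGrad C (X i ω)
    let m := D.model C (u i ω * ‖g‖) (X i ω)
    ¬ (c.eta1 ≤ (D.cost C (X i ω) - D.cost C (X i ω + S i ω)) / (m 0 - m (S i ω)) ∧
        c.eta2 / u i ω ≤ ‖g‖) →
      X (i + 1) ω = X i ω ∧ u (i + 1) ω = c.lam * u i ω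

/-- The largest eigenvalue of the covariance matrix of the random vector `Y`, with the value `∞`
when `Y` has no finite second moment. -/
def topCovEigenvalue {n : ℕ} {Ω : Type*} [MeasurableSpace Ω] (Y : Ω → E n) (P : Measure Ω) :
    ℝ≥0∞ :=
  open Classical in
  if MemLp Y 2 P then
    ENNReal.ofReal (sSup {l : ℝ | Module.End.HasEigenvalue
      (Matrix.toLin' (Matrix.of fun a b : Fin n =>
        covariance (fun ω => Y ω a) (fun ω => Y ω b) P)) l})
  else ∞

namespace Run

variable {n d : ℕ} {D : Problem n d} {c : Params} {N : ℕ} {Ω : Type*} [MeasurableSpace Ω]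
  {P : Measure Ω} (r : Run D c N P)

/-- The empirical covariance `B^N` used at iteration `i`. -/
def B (i : ℕ) (ω : Ω) : Matrix (Fin n) (Fin n) ℝ := empCov D.zb (fun k => r.z i k ω)

/-- The estimate `F⁰` of `f(X)` at iteration `i`. -/
def F0 (i : ℕ) (ω : Ω) : ℝ := D.cost (r.B i ω) (r.X i ω)

/-- The estimate `F¹` of `f(X + S)` at iteration `i`. -/
def F1 (i : ℕ) (ω : Ω) : ℝ := D.cost (r.B i ω) (r.X i ω + r.S i ω)

/-- The regularization `γ = μ ‖g‖`, where `g` is the model gradient. -/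
def gam (i : ℕ) (ω : Ω) : ℝ := r.u i ω * ‖D.modelGrad (r.B i ω) (r.X i ω)‖

/-- The random model at iteration `i`, as a function of the step; `r.model i ω 0` is the model
value at the current iterate. -/
def model (i : ℕ) (ω : Ω) (s : E n) : ℝ := D.model (r.B i ω) (r.gam i ω) (r.X i ω) s

/-- The history up to the iterate `j`: the σ-algebra generated by all iterates and parameters
up to `j`, and by the trial steps, the function estimates and the models of the iterations
before `j`. -/
@[reducible]
def history (j : ℕ) : MeasurableSpace Ω :=
  (⨆ i : Fin (j + 1), MeasurableSpace.comap (r.X i) inferInstance ⊔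
      MeasurableSpace.comap (r.u i) inferInstance) ⊔
  (⨆ i : Fin j, MeasurableSpace.comap (r.S i) inferInstance ⊔
      MeasurableSpace.comap (r.F0 i) inferInstance ⊔
      MeasurableSpace.comap (r.F1 i) inferInstance ⊔
      MeasurableSpace.comap (r.model i) MeasurableSpace.pi)

/-- The σ-algebra generated by the ensemble of iteration `j`. -/
@[reducible]
def ensembleSigma (j : ℕ) : MeasurableSpace Ω :=
  MeasurableSpace.comap (fun ω k => r.z j k ω) (MeasurableSpace.pi (X := fun _ : Fin N => E n))

/-- For a fixed point `x`, the variance (in `[0, ∞]`) of `‖x - z_b‖²_{(B^N)⁻¹}` over the ensemble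
of iteration `j`. -/
def varNormSq (j : ℕ) (x : E n) : ℝ≥0∞ :=
  evariance (fun ω => wnormSq (r.B j ω)⁻¹ (x - D.zb)) P

/-- For a fixed point `x`, the largest eigenvalue (in `[0, ∞]`) of the covariance matrix
of `(B^N)⁻¹ (x - z_b)` over the ensemble of iteration `j`. -/
def lambdaMax (j : ℕ) (x : E n) : ℝ≥0∞ :=
  topCovEigenvalue (fun ω => matVec (r.B j ω)⁻¹ (x - D.zb)) P

end Run

/-- `min {λʲ μ₀, μ_max}`. -/
def Params.muBar (c : Params) (j : ℕ) : ℝ := min (c.lam ^ j * c.mu0) c.muMax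

/-- The threshold constant `ℵ`, for the current iterate `x` and the trial step `s`. -/
def aleph {n d : ℕ} (D : Problem n d) (μ εf κef κeg : ℝ) (x s : E n) : ℝ :=
  max (max (wnormSq D.Binf⁻¹ (x - D.zb) / (2 * εf)) (wnormSq D.Binf⁻¹ (x + s - D.zb) / (2 * εf)))
    (max (wnormSq D.Binf⁻¹ (x - D.zb) / (2 * κef))
      (‖matVec D.Binf⁻¹ (x - D.zb)‖ / (κeg * μ)))

/-- `2κ / μ² - n / (N - 1 - n) ‖x - z_b‖²_{(B^∞)⁻¹}`. -/
def thetaGap {n d : ℕ} (D : Problem n d) (N : ℕ) (μ κ : ℝ) (x : E n) : ℝ :=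
  2 * κ / μ ^ 2 - (n : ℝ) / ((N : ℝ) - 1 - n) * wnormSq D.Binf⁻¹ (x - D.zb)

/-- `κ / μ - n / (N - 1 - n) ‖(B^∞)⁻¹ (x - z_b)‖`. -/
def upsilonGap {n d : ℕ} (D : Problem n d) (N : ℕ) (μ κ : ℝ) (x : E n) : ℝ :=
  κ / μ - (n : ℝ) / ((N : ℝ) - 1 - n) * ‖matVec D.Binf⁻¹ (x - D.zb)‖

end DataAssim

end

namespace DataAssim

/-! Conditioning on `G` freezes the iterate, the parameter and, for the second bound, the trial
step: these are `G`-measurable, while the ensemble is independent of `G`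
(`condProb_ae_eq_of_indep`). At a frozen point the observation terms cancel in all four errors
(`f_sub_cost`, `gradient_f_sub_modelGrad`), so only the difference between the exact and the
empirical inverse covariance remains. Each such error is a fluctuation around the mean plus a bias.
Subtracting the bias from the tolerance leaves the gap, and Chebyshev's inequality bounds the
probability that the fluctuation reaches it (`one_sub_evariance_div_le`, `meas_norm_sub_ge_le`). The
condition on `N` makes the gap positive (`gap_pos`), and `u_bounds` allows the parameter to be
replaced by `muBar`.

The bias comes from E (B^N)⁻¹ = (1 + n/(N-1-n)) (B^∞)⁻¹ (`integral_bilinear_inv_empCov`). Whitening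
by the square root of B^∞ reduces this to E (YᵀY)⁻¹ = (N-n-1)⁻¹ for an N × n matrix Y of independent
standard normals.

No Wishart density is used. Put A = (YᵀY + δ)⁻¹, whose entries, like those of YA, are bounded for
fixed δ > 0. Stein's identity for the entries of YA, summed over the rows of Y, shows that (N-n-1)A
+ δA + δA² + δ tr(A) A has mean 1 (`integral_regInv`). The last three terms are positive
semidefinite, so E A is bounded uniformly in δ. This bound gives almost sure invertibility of YᵀY
(`ae_det_gram_ne_zero`) and, by Fatou, integrability of its inverse. Dominated convergence as δ → 0
then gives the exact mean. -/

/-! ### Stein's identity: from the line to Gaussian matrices. -/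

theorem hasDerivAt_gaussianPDFReal_zero_one (x : ℝ) :
    HasDerivAt (gaussianPDFReal 0 1) (-(x * gaussianPDFReal 0 1 x)) x := by
  have h1 : HasDerivAt (fun x : ℝ => -(x - 0) ^ 2 / (2 * ((1 : NNReal) : ℝ))) (-x) x := by
    have := (((hasDerivAt_id x).sub_const 0).pow 2).neg.div_const (2 * ((1 : NNReal) : ℝ))
    refine this.congr_deriv ?_
    simp
    ring
  have h2 := (h1.exp).const_mul (√(2 * Real.pi * ((1 : NNReal) : ℝ)))⁻¹
  rw [gaussianPDFReal_def]
  refine h2.congr_deriv ?_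
  simp only
  ring

theorem integrable_mul_of_bound {α : Type*} [MeasurableSpace α] {μ : Measure α} {f g : α → ℝ}
    (hg : Integrable g μ) (hf : AEStronglyMeasurable f μ) {C : ℝ} (hC : ∀ x, |f x| ≤ C) :
    Integrable (fun x => f x * g x) μ :=
  hg.bdd_mul hf (ae_of_all _ hC)

/-- Stein's identity for the standard normal law on the line. -/
theorem integral_mul_gaussianReal_eq_integral_deriv {h h' : ℝ → ℝ}
    (hd : ∀ x, HasDerivAt h (h' x) x) {C C' : ℝ} (hC : ∀ x, |h x| ≤ C) (hC' : ∀ x, |h' x| ≤ C') :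
    ∫ x, x * h x ∂(gaussianReal 0 1) = ∫ x, h' x ∂(gaussianReal 0 1) := by
  have hcont : Continuous h := continuous_iff_continuousAt.2 fun x => (hd x).continuousAt
  have hh' : h' = deriv h := funext fun x => (hd x).deriv.symm
  have hmeas : Measurable h' := hh' ▸ measurable_deriv h
  have hpdf : Integrable (gaussianPDFReal 0 1) := integrable_gaussianPDFReal 0 1
  have hid : Integrable (fun x => x * gaussianPDFReal 0 1 x) := by
    have h0 : Integrable (fun x : ℝ => x) (gaussianReal 0 1) := IsGaussian.integrable_fun_id
    rw [gaussianReal_of_var_ne_zero 0 one_ne_zero] at h0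
    have := (integrable_withDensity_iff_integrable_smul' (measurable_gaussianPDF 0 1)
      (ae_of_all _ fun _ => gaussianPDF_lt_top)).1 h0
    simpa [toReal_gaussianPDF, mul_comm] using this
  -- Integration by parts against the density φ, with φ' = -xφ. There are no boundary terms, since h
  -- and h' are bounded and both φ and xφ are integrable.
  have key := integral_mul_deriv_eq_deriv_mul_of_integrable (u := h) (v := gaussianPDFReal 0 1)
    (fun x _ => hd x) (fun x _ => hasDerivAt_gaussianPDFReal_zero_one x)
    (integrable_mul_of_bound (g := fun x => -(x * gaussianPDFReal 0 1 x)) hid.neg hcont.aestronglyMeasurable hC)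
    (integrable_mul_of_bound hpdf hmeas.aestronglyMeasurable hC')
    (integrable_mul_of_bound hpdf hcont.aestronglyMeasurable hC)
  rw [integral_gaussianReal_eq_integral_smul one_ne_zero,
    integral_gaussianReal_eq_integral_smul one_ne_zero]
  simp only [smul_eq_mul, mul_neg, integral_neg, neg_inj] at key ⊢
  rw [show (fun x => gaussianPDFReal 0 1 x * h' x) = fun x => h' x * gaussianPDFReal 0 1 x from
    funext fun x => mul_comm _ _, ← key]
  exact integral_congr_ae (ae_of_all _ fun x => by simp only; ring)

/-- Resampling one coordinate does not change a product law. -/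
theorem map_update_pi {ι : Type*} [Fintype ι] [DecidableEq ι] {X : ι → Type*}
    [∀ i, MeasurableSpace (X i)] (μ : ∀ i, Measure (X i)) [∀ i, IsProbabilityMeasure (μ i)]
    (i : ι) :
    ((Measure.pi μ).prod (μ i)).map (fun p => Function.update p.1 i p.2) = Measure.pi μ := by
  have hm : Measurable fun p : (∀ j, X j) × X i => Function.update p.1 i p.2 := by
    rw [measurable_pi_iff]
    intro j
    by_cases h : j = i
    · subst h
      simpa using measurable_snd
    · simp only [Function.update_of_ne h]
      exact (measurable_pi_apply j).comp measurable_fst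
  refine (Measure.pi_eq fun s hs => ?_).symm
  rw [Measure.map_apply hm (MeasurableSet.univ_pi hs)]
  have : (fun p : (∀ j, X j) × X i => Function.update p.1 i p.2) ⁻¹' Set.univ.pi s
      = (Set.univ.pi (Function.update s i Set.univ)) ×ˢ s i := by
    ext p
    simp only [Set.mem_preimage, Set.mem_pi, Set.mem_univ, forall_true_left, Set.mem_prod]
    constructor
    · intro h
      refine ⟨fun j => ?_, by simpa using h i⟩
      by_cases hj : j = i
      · subst hj; simp
      · simpa [Function.update_of_ne hj] using h j
    · rintro ⟨h1, h2⟩ j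
      by_cases hj : j = i
      · subst hj; simpa using h2
      · simpa [Function.update_of_ne hj] using h1 j
  rw [this, Measure.prod_prod, Measure.pi_pi, ← Finset.mul_prod_erase _ _ (Finset.mem_univ i),
    ← Finset.mul_prod_erase Finset.univ (fun j => μ j (s j)) (Finset.mem_univ i), mul_comm]
  simp only [Function.update_self, measure_univ, one_mul]
  congr 1
  refine Finset.prod_congr rfl fun j hj => ?_
  rw [Function.update_of_ne (Finset.ne_of_mem_erase hj)]

/-- By `map_update_pi` and Fubini. The inner integral varies one coordinate with the others frozen,
which is where the identity of lower dimension applies. -/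
theorem integral_pi_eq_integral_update {ι : Type*} [Fintype ι] [DecidableEq ι] {X : ι → Type*}
    [∀ i, MeasurableSpace (X i)] (μ : ∀ i, Measure (X i)) [∀ i, IsProbabilityMeasure (μ i)]
    (i : ι) {F : (∀ j, X j) → ℝ} (hF : Integrable F (Measure.pi μ)) :
    ∫ x, F x ∂(Measure.pi μ) = ∫ x, ∫ t, F (Function.update x i t) ∂(μ i) ∂(Measure.pi μ) := by
  have hm : AEMeasurable (fun p : (∀ j, X j) × X i => Function.update p.1 i p.2)
      ((Measure.pi μ).prod (μ i)) := by
    -- The pushforward along a map that is not a.e. measurable is zero by convention, whereas this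
    -- one is a probability measure.
    apply AEMeasurable.of_map_ne_zero
    rw [map_update_pi]
    exact IsProbabilityMeasure.ne_zero _
  have hF' := hF
  rw [← map_update_pi μ i] at hF'
  conv_lhs => rw [← map_update_pi μ i]
  rw [integral_map hm hF'.1, integral_prod]
  exact hF'.comp_aemeasurable hm

/-- Stein's identity for a vector of independent standard normal variables. -/
theorem integral_mul_pi_gaussianReal {ι : Type*} [Fintype ι] [DecidableEq ι]
    {F F' : (ι → ℝ) → ℝ} (i : ι) (hF : Measurable F) (hF' : Measurable F') {C C' : ℝ}
    (hC : ∀ x, |F x| ≤ C) (hC' : ∀ x, |F' x| ≤ C')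
    (hd : ∀ x, HasDerivAt (fun t => F (Function.update x i t)) (F' x) (x i)) :
    ∫ x, F x * x i ∂(Measure.pi fun _ : ι => gaussianReal 0 1)
      = ∫ x, F' x ∂(Measure.pi fun _ : ι => gaussianReal 0 1) := by
  have hi : Integrable (fun x : ι → ℝ => x i) (Measure.pi fun _ : ι => gaussianReal 0 1) :=
    integrable_eval IsGaussian.integrable_id
  have h1 : Integrable F' (Measure.pi fun _ : ι => gaussianReal 0 1) :=
    Integrable.of_bound hF'.aestronglyMeasurable C' (ae_of_all _ hC')
  rw [integral_pi_eq_integral_update _ i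
    (integrable_mul_of_bound hi hF.aestronglyMeasurable hC),
    integral_pi_eq_integral_update _ i h1]
  refine integral_congr_ae (ae_of_all _ fun x => ?_)
  simp only [Function.update_self]
  rw [← integral_mul_gaussianReal_eq_integral_deriv (h := fun t => F (Function.update x i t))
    (h' := fun t => F' (Function.update x i t)) (fun t => ?_) (fun _ => hC _) (fun _ => hC' _)]
  · exact integral_congr_ae (ae_of_all _ fun t => mul_comm _ _)
  · simpa using hd (Function.update x i t)

/-- The law of a matrix with independent standard normal entries. -/
noncomputable abbrev gaussianMatrix (κ ι : Type*) [Fintype κ] [Fintype ι] :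
    Measure (κ → ι → ℝ) :=
  Measure.pi fun _ : κ => Measure.pi fun _ : ι => gaussianReal 0 1

/-- Stein's identity for a matrix of independent standard normal variables. -/
theorem integral_mul_gaussianMatrix {κ ι : Type*} [Fintype κ] [DecidableEq κ] [Fintype ι]
    [DecidableEq ι] {F F' : (κ → ι → ℝ) → ℝ} (k : κ) (i : ι) (hF : Measurable F)
    (hF' : Measurable F') {C C' : ℝ} (hC : ∀ y, |F y| ≤ C) (hC' : ∀ y, |F' y| ≤ C')
    (hd : ∀ y, HasDerivAt (fun t => F (Function.update y k (Function.update (y k) i t)))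
      (F' y) (y k i)) :
    ∫ y, F y * y k i ∂(gaussianMatrix κ ι) = ∫ y, F' y ∂(gaussianMatrix κ ι) := by
  have hi : Integrable (fun y : κ → ι → ℝ => y k i) (gaussianMatrix κ ι) :=
    integrable_comp_eval (i := k) (μ := fun _ : κ => Measure.pi fun _ : ι => gaussianReal 0 1)
      (f := fun v : ι → ℝ => v i) (integrable_eval (IsGaussian.integrable_id (μ := gaussianReal 0 1)))
  have h1 : Integrable F' (gaussianMatrix κ ι) :=
    Integrable.of_bound hF'.aestronglyMeasurable C' (ae_of_all _ hC')
  rw [integral_pi_eq_integral_update _ k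
    (integrable_mul_of_bound hi hF.aestronglyMeasurable hC),
    integral_pi_eq_integral_update _ k h1]
  refine integral_congr_ae (ae_of_all _ fun y => ?_)
  simp only [Function.update_self]
  refine integral_mul_pi_gaussianReal (F := fun v => F (Function.update y k v))
    (F' := fun v => F' (Function.update y k v)) i (hF.comp (measurable_update y))
    (hF'.comp (measurable_update y)) (fun _ => hC _) (fun _ => hC' _) fun v => ?_
  simpa using hd (Function.update y k v)

/-! ### The regularized inverse Gram matrix: identities, bounds, derivative. -/

section Resolvent

variable {κ ι : Type*} [Fintype κ] [Fintype ι] [DecidableEq ι]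

/-- The regularized inverse Gram matrix `(YᵀY + δ)⁻¹`. -/
noncomputable def regInv (δ : ℝ) (Y : Matrix κ ι ℝ) : Matrix ι ι ℝ :=
  (Y.transpose * Y + δ • (1 : Matrix ι ι ℝ))⁻¹

theorem posDef_gram_add {δ : ℝ} (hδ : 0 < δ) (Y : Matrix κ ι ℝ) :
    (Y.transpose * Y + δ • (1 : Matrix ι ι ℝ)).PosDef := by
  have h := Matrix.posSemidef_conjTranspose_mul_self Y
  rw [Matrix.conjTranspose_eq_transpose_of_trivial] at h
  exact Matrix.PosDef.posSemidef_add h (Matrix.PosDef.one.smul hδ)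

theorem isUnit_det_gram_add {δ : ℝ} (hδ : 0 < δ) (Y : Matrix κ ι ℝ) :
    IsUnit (Y.transpose * Y + δ • (1 : Matrix ι ι ℝ)).det :=
  (posDef_gram_add hδ Y).det_pos.ne'.isUnit

theorem transpose_regInv (δ : ℝ) (Y : Matrix κ ι ℝ) : (regInv δ Y).transpose = regInv δ Y := by
  rw [regInv, Matrix.transpose_nonsing_inv]
  simp [Matrix.transpose_mul]

theorem gram_mul_regInv {δ : ℝ} (hδ : 0 < δ) (Y : Matrix κ ι ℝ) :
    Y.transpose * (Y * regInv δ Y) = 1 - δ • regInv δ Y := by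
  have h := Matrix.mul_nonsing_inv _ (isUnit_det_gram_add hδ Y)
  rw [← regInv, Matrix.add_mul, Matrix.smul_mul, Matrix.one_mul, Matrix.mul_assoc] at h
  exact eq_sub_of_add_eq h

/-- Multiply `gram_mul_regInv` on the left by A = `regInv δ Y`. In the form A = (YA)ᵀ(YA) + δA² this
writes A as a sum of two squares, from which the bounds on the entries of A and YA follow. -/
theorem regInv_eq {δ : ℝ} (hδ : 0 < δ) (Y : Matrix κ ι ℝ) :
    (Y * regInv δ Y).transpose * (Y * regInv δ Y) = regInv δ Y - δ • (regInv δ Y * regInv δ Y) := by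
  rw [Matrix.transpose_mul, transpose_regInv, Matrix.mul_assoc, gram_mul_regInv hδ, Matrix.mul_sub,
    Matrix.mul_one, Matrix.mul_smul]

theorem regInv_apply_symm (δ : ℝ) (Y : Matrix κ ι ℝ) (a b : ι) :
    regInv δ Y a b = regInv δ Y b a := by
  conv_lhs => rw [← transpose_regInv, Matrix.transpose_apply]

theorem regInv_diag {δ : ℝ} (hδ : 0 < δ) (Y : Matrix κ ι ℝ) (i : ι) :
    regInv δ Y i i = ∑ k, (Y * regInv δ Y) k i ^ 2 + δ * ∑ a, regInv δ Y i a ^ 2 := by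
  have h := congrFun (congrFun (regInv_eq hδ Y) i) i
  rw [Matrix.sub_apply, Matrix.smul_apply, Matrix.mul_apply, Matrix.mul_apply (M := regInv δ Y)] at h
  simp only [Matrix.transpose_apply, smul_eq_mul] at h
  simp only [sq]
  rw [h, sub_add_eq_add_sub]
  simp only [regInv_apply_symm δ Y _ i]
  ring

theorem regInv_diag_nonneg {δ : ℝ} (hδ : 0 < δ) (Y : Matrix κ ι ℝ) (i : ι) :
    0 ≤ regInv δ Y i i := by
  rw [regInv_diag hδ]
  positivity

theorem mul_sq_regInv_le {δ : ℝ} (hδ : 0 < δ) (Y : Matrix κ ι ℝ) (i a : ι) :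
    δ * regInv δ Y i a ^ 2 ≤ regInv δ Y i i := by
  conv_rhs => rw [regInv_diag hδ]
  have h1 : regInv δ Y i a ^ 2 ≤ ∑ a, regInv δ Y i a ^ 2 :=
    Finset.single_le_sum (f := fun a => regInv δ Y i a ^ 2) (fun _ _ => sq_nonneg _)
      (Finset.mem_univ a)
  have h2 : 0 ≤ ∑ k, (Y * regInv δ Y) k i ^ 2 := by positivity
  nlinarith

theorem regInv_diag_le {δ : ℝ} (hδ : 0 < δ) (Y : Matrix κ ι ℝ) (i : ι) :
    regInv δ Y i i ≤ δ⁻¹ := by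
  have h := mul_sq_regInv_le hδ Y i i
  have h0 := regInv_diag_nonneg hδ Y i
  rw [← mul_le_mul_iff_right₀ hδ, mul_inv_cancel₀ hδ.ne']
  by_contra! hc
  nlinarith

theorem abs_regInv_le {δ : ℝ} (hδ : 0 < δ) (Y : Matrix κ ι ℝ) (i a : ι) :
    |regInv δ Y i a| ≤ δ⁻¹ := by
  refine abs_le_of_sq_le_sq ?_ (by positivity)
  have h := (mul_sq_regInv_le hδ Y i a).trans (regInv_diag_le hδ Y i)
  rw [← mul_le_mul_iff_right₀ hδ]
  refine h.trans (le_of_eq ?_)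
  field_simp

theorem sq_mul_regInv_le {δ : ℝ} (hδ : 0 < δ) (Y : Matrix κ ι ℝ) (k : κ) (i : ι) :
    (Y * regInv δ Y) k i ^ 2 ≤ δ⁻¹ := by
  refine le_trans ?_ (regInv_diag_le hδ Y i)
  rw [regInv_diag hδ]
  have h1 : (Y * regInv δ Y) k i ^ 2 ≤ ∑ k, (Y * regInv δ Y) k i ^ 2 :=
    Finset.single_le_sum (f := fun k => (Y * regInv δ Y) k i ^ 2) (fun _ _ => sq_nonneg _)
      (Finset.mem_univ k)
  have h2 : 0 ≤ δ * ∑ a, regInv δ Y i a ^ 2 := by positivity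
  linarith

/-- The constant avoids a square root: δ⁻¹ ≤ (δ⁻¹ + 1)². Only boundedness for fixed δ matters. -/
theorem abs_mul_regInv_le {δ : ℝ} (hδ : 0 < δ) (Y : Matrix κ ι ℝ) (k : κ) (i : ι) :
    |(Y * regInv δ Y) k i| ≤ δ⁻¹ + 1 := by
  refine abs_le_of_sq_le_sq ?_ (by positivity)
  have := sq_mul_regInv_le hδ Y k i
  have h : 0 < δ⁻¹ := by positivity
  nlinarith

/-- Cyclicity of the trace turns Y A Yᵀ into YᵀYA = 1 - δA. It evaluates the hat diagonals once
Stein's identity is summed over the rows. -/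
theorem trace_hat {δ : ℝ} (hδ : 0 < δ) (Y : Matrix κ ι ℝ) :
    ∑ k, (Y * regInv δ Y * Y.transpose) k k = Fintype.card ι - δ * (regInv δ Y).trace := by
  have h : ∑ k, (Y * regInv δ Y * Y.transpose) k k = (Y * regInv δ Y * Y.transpose).trace := rfl
  rw [h, Matrix.trace_mul_comm, gram_mul_regInv hδ, Matrix.trace_sub, Matrix.trace_smul,
    Matrix.trace_one, smul_eq_mul]

theorem hat_diag_nonneg {δ : ℝ} (hδ : 0 < δ) (Y : Matrix κ ι ℝ) (k : κ) :
    0 ≤ (Y * regInv δ Y * Y.transpose) k k := by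
  have h := ((posDef_gram_add hδ Y).inv.posSemidef).mul_mul_conjTranspose_same Y
  rw [Matrix.conjTranspose_eq_transpose_of_trivial] at h
  exact h.diag_nonneg

theorem regInv_trace_nonneg {δ : ℝ} (hδ : 0 < δ) (Y : Matrix κ ι ℝ) :
    0 ≤ (regInv δ Y).trace :=
  Finset.sum_nonneg fun i _ => regInv_diag_nonneg hδ Y i

theorem abs_hat_diag_le {δ : ℝ} (hδ : 0 < δ) (Y : Matrix κ ι ℝ) (k : κ) :
    |(Y * regInv δ Y * Y.transpose) k k| ≤ Fintype.card ι := by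
  rw [abs_of_nonneg (hat_diag_nonneg hδ Y k)]
  have h1 := Finset.single_le_sum (f := fun k => (Y * regInv δ Y * Y.transpose) k k)
    (fun k _ => hat_diag_nonneg hδ Y k) (Finset.mem_univ k)
  have h2 := mul_nonneg hδ.le (regInv_trace_nonneg hδ Y)
  have h3 := trace_hat hδ Y
  linarith

/-- The directional derivative of `Y ↦ Y (YᵀY + δ)⁻¹`. -/
theorem hasDerivAt_mul_regInv {δ : ℝ} (hδ : 0 < δ) (Y E : Matrix κ ι ℝ) (t₀ : ℝ) (k : κ) (a : ι) :
    HasDerivAt (fun t : ℝ => ((Y + (t - t₀) • E) * regInv δ (Y + (t - t₀) • E)) k a)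
      ((E * regInv δ Y - Y * (regInv δ Y * (E.transpose * Y + Y.transpose * E) * regInv δ Y)) k a)
      t₀ := by
  -- A submultiplicative norm is chosen locally, only to differentiate inversion in a normed
  -- algebra; the conclusion concerns single real entries.
  let _ : NormedRing (Matrix ι ι ℝ) := Matrix.linftyOpNormedRing
  let _ : NormedAlgebra ℝ (Matrix ι ι ℝ) := Matrix.linftyOpNormedAlgebra
  have hs : HasDerivAt (fun t : ℝ => t - t₀) 1 t₀ := (hasDerivAt_id t₀).sub_const t₀
  have hM : HasDerivAt (fun t : ℝ => (Y + (t - t₀) • E).transpose * (Y + (t - t₀) • E)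
      + δ • (1 : Matrix ι ι ℝ)) (E.transpose * Y + Y.transpose * E) t₀ := by
    have h1 : HasDerivAt (fun t : ℝ => (t - t₀) • (E.transpose * Y + Y.transpose * E))
        ((1 : ℝ) • (E.transpose * Y + Y.transpose * E)) t₀ := hs.smul_const _
    have h2 : HasDerivAt (fun t : ℝ => (t - t₀) ^ 2 • (E.transpose * E))
        ((2 * (t₀ - t₀) ^ (2 - 1) * (1 : ℝ)) • (E.transpose * E)) t₀ := (hs.pow 2).smul_const _
    have h3 := ((h1.add h2).const_add (Y.transpose * Y)).add_const (δ • (1 : Matrix ι ι ℝ))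
    refine (h3.congr_deriv (by simp)).congr_of_eventuallyEq (Filter.Eventually.of_forall fun t => ?_)
    simp only [Matrix.transpose_add, Matrix.transpose_smul, Matrix.add_mul, Matrix.mul_add,
      Matrix.smul_mul, Matrix.mul_smul, smul_smul, sq, Pi.add_apply, smul_add]
    abel
  have hu : IsUnit (Y.transpose * Y + δ • (1 : Matrix ι ι ℝ)) :=
    (Matrix.isUnit_iff_isUnit_det _).2 (isUnit_det_gram_add hδ Y)
  have hA : HasDerivAt (fun t : ℝ => regInv δ (Y + (t - t₀) • E))
      (-(regInv δ Y * (E.transpose * Y + Y.transpose * E) * regInv δ Y)) t₀ := by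
    have h0 := hasFDerivAt_ringInverse (𝕜 := ℝ) hu.unit
    have h1 : (hu.unit : Matrix ι ι ℝ) = (Y + (t₀ - t₀) • E).transpose * (Y + (t₀ - t₀) • E)
      + δ • (1 : Matrix ι ι ℝ) := by simp
    have h2 : ((hu.unit⁻¹ : (Matrix ι ι ℝ)ˣ) : Matrix ι ι ℝ) = regInv δ Y := by
      rw [Matrix.coe_units_inv]; rfl
    rw [h1, h2] at h0
    have h3 := h0.comp_hasDerivAt t₀ hM
    refine (h3.congr_deriv ?_).congr_of_eventuallyEq (Filter.Eventually.of_forall fun t => ?_)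
    · simp
    · simp [regInv, Matrix.nonsing_inv_eq_ringInverse]
  have hAe : ∀ b : ι, HasDerivAt (fun t : ℝ => regInv δ (Y + (t - t₀) • E) b a)
      ((-(regInv δ Y * (E.transpose * Y + Y.transpose * E) * regInv δ Y)) b a) t₀ := by
    intro b
    let ℓ : Matrix ι ι ℝ →ₗ[ℝ] ℝ :=
      { toFun := fun M => M b a, map_add' := fun _ _ => rfl, map_smul' := fun _ _ => rfl }
    exact (LinearMap.toContinuousLinearMap ℓ).hasFDerivAt.comp_hasDerivAt t₀ hA
  have hYe : ∀ b : ι, HasDerivAt (fun t : ℝ => (Y + (t - t₀) • E) k b) (E k b) t₀ := by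
    intro b
    have := (hs.mul_const (E k b)).const_add (Y k b)
    simpa using this
  have := HasDerivAt.fun_sum (u := Finset.univ) fun b _ => (hYe b).mul (hAe b)
  refine (this.congr_deriv ?_).congr_of_eventuallyEq (Filter.Eventually.of_forall fun t => ?_)
  · simp only [sub_self, zero_smul, add_zero, Matrix.neg_apply, mul_neg, Finset.sum_add_distrib,
      Finset.sum_neg_distrib, Matrix.sub_apply]
    rw [Matrix.mul_apply, Matrix.mul_apply (M := Y), sub_eq_add_neg]
  · simp [Matrix.mul_apply]

end Resolvent

/-! ### Measurability, and the mean identity for the regularized inverse. -/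

theorem inv_apply_eq {ι : Type*} [Fintype ι] [DecidableEq ι] (M : Matrix ι ι ℝ) (a b : ι) :
    M⁻¹ a b = M.det⁻¹ * M.adjugate a b := by
  rw [Matrix.inv_def, Matrix.smul_apply, Ring.inverse_eq_inv', smul_eq_mul]

/-- Cramer's rule: adjugate over determinant, both continuous in the matrix. It holds for singular
matrices as well, since both inverses are then zero, so invertibility is not needed. -/
theorem measurable_inv_apply {α ι : Type*} [MeasurableSpace α] [Fintype ι] [DecidableEq ι]
    {M : α → Matrix ι ι ℝ} (hM : ∀ a b, Measurable fun x => M x a b) (a b : ι) :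
    Measurable fun x => (M x)⁻¹ a b := by
  have h0 : Measurable fun x => (fun i j => M x i j : ι → ι → ℝ) :=
    measurable_pi_lambda _ fun i => measurable_pi_lambda _ fun j => hM i j
  have h1 : Measurable fun m : ι → ι → ℝ => (Matrix.of m)⁻¹ a b := by
    simp only [inv_apply_eq]
    have hc : Continuous fun m : ι → ι → ℝ => (Matrix.of m : Matrix ι ι ℝ) := continuous_id
    exact hc.matrix_det.measurable.inv.mul (hc.matrix_adjugate.matrix_elem a b).measurable
  exact h1.comp h0

theorem update_eq_add_single {κ ι : Type*} [DecidableEq κ] [DecidableEq ι]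
    (y : κ → ι → ℝ) (k : κ) (i : ι) (t : ℝ) :
    Matrix.of (Function.update y k (Function.update (y k) i t))
      = Matrix.of y + (t - y k i) • Matrix.single k i (1 : ℝ) := by
  ext l b
  simp only [Matrix.of_apply, Matrix.add_apply, Matrix.smul_apply, Matrix.single_apply]
  by_cases hl : l = k
  · subst hl
    by_cases hb : b = i
    · subst hb; simp
    · simp [hb, Ne.symm hb]
  · simp [hl, Ne.symm hl]

section

variable {κ ι : Type*} [Fintype κ] [Fintype ι] [DecidableEq ι]

theorem measurable_regInv (δ : ℝ) (i a : ι) :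
    Measurable fun y : κ → ι → ℝ => regInv δ (Matrix.of y) i a := by
  refine measurable_inv_apply (M := fun y : κ → ι → ℝ =>
    (Matrix.of y).transpose * Matrix.of y + δ • (1 : Matrix ι ι ℝ)) (fun a b => ?_) i a
  simp only [Matrix.add_apply, Matrix.mul_apply, Matrix.transpose_apply, Matrix.of_apply]
  fun_prop

theorem measurable_mul_regInv (δ : ℝ) (k : κ) (a : ι) :
    Measurable fun y : κ → ι → ℝ => (Matrix.of y * regInv δ (Matrix.of y)) k a := by
  simp only [Matrix.mul_apply, Matrix.of_apply]
  have := fun i => measurable_regInv (κ := κ) δ i a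
  fun_prop

theorem measurable_hat_diag (δ : ℝ) (k : κ) :
    Measurable fun y : κ → ι → ℝ =>
      (Matrix.of y * regInv δ (Matrix.of y) * (Matrix.of y).transpose) k k := by
  have h : ∀ y : κ → ι → ℝ,
      (Matrix.of y * regInv δ (Matrix.of y) * (Matrix.of y).transpose) k k
        = ∑ a, (Matrix.of y * regInv δ (Matrix.of y)) k a * y k a := fun y => rfl
  simp only [h]
  exact Finset.measurable_sum _ fun a _ => (measurable_mul_regInv δ k a).mul
    ((measurable_pi_apply a).comp (measurable_pi_apply k))

/-- Changing one entry moves Y along the matrix unit `single k i 1`. In the derivative of A the two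
summands of EᵀY + YᵀE contribute the product (YA)ₖᵢ(YA)ₖₐ and the hat diagonal times Aᵢₐ. -/
theorem hasDerivAt_entry_mul_regInv [DecidableEq κ] {δ : ℝ} (hδ : 0 < δ) (y : κ → ι → ℝ)
    (k : κ) (i a : ι) :
    HasDerivAt (fun t =>
        (Matrix.of (Function.update y k (Function.update (y k) i t)) *
          regInv δ (Matrix.of (Function.update y k (Function.update (y k) i t)))) k a)
      (regInv δ (Matrix.of y) i a
        - ((Matrix.of y * regInv δ (Matrix.of y)) k i * (Matrix.of y * regInv δ (Matrix.of y)) k a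
          + (Matrix.of y * regInv δ (Matrix.of y) * (Matrix.of y).transpose) k k
            * regInv δ (Matrix.of y) i a)) (y k i) := by
  simp only [update_eq_add_single]
  refine (hasDerivAt_mul_regInv hδ (Matrix.of y) (Matrix.single k i 1) (y k i) k a).congr_deriv ?_
  generalize Matrix.of y = Y
  generalize regInv δ Y = A
  have h1 : Y * (A * ((Matrix.single k i (1 : ℝ)).transpose * Y
      + Y.transpose * Matrix.single k i (1 : ℝ)) * A)
      = (Y * A) * Matrix.single i k (1 : ℝ) * (Y * A)
        + (Y * A * Y.transpose) * Matrix.single k i (1 : ℝ) * A := by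
    rw [Matrix.transpose_single]
    simp only [Matrix.mul_add, Matrix.add_mul, Matrix.mul_assoc]
  rw [h1, Matrix.sub_apply, Matrix.add_apply, Matrix.single_mul_apply_same, one_mul]
  generalize Y * A = W
  generalize W * Y.transpose = H
  rw [Matrix.mul_apply, Matrix.mul_apply (N := A)]
  congr 2
  · rw [Finset.sum_eq_single k]
    · simp
    · intro b _ hb; simp [hb]
    · simp
  · rw [Finset.sum_eq_single i]
    · simp
    · intro b _ hb; simp [hb]
    · simp

theorem integrable_of_measurable_bound {α : Type*} [MeasurableSpace α] {μ : Measure α}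
    [IsFiniteMeasure μ] {f : α → ℝ} (hf : Measurable f) {C : ℝ} (hC : ∀ x, |f x| ≤ C) :
    Integrable f μ :=
  Integrable.of_bound hf.aestronglyMeasurable C (ae_of_all _ hC)

/-- Stein's identity for one entry of `Y (YᵀY + δ)⁻¹`. -/
theorem integral_mul_regInv_mul [DecidableEq κ] {δ : ℝ} (hδ : 0 < δ) (k : κ) (i a : ι) :
    ∫ y, (Matrix.of y * regInv δ (Matrix.of y)) k a * y k i ∂(gaussianMatrix κ ι)
      = ∫ y, (regInv δ (Matrix.of y) i a
        - ((Matrix.of y * regInv δ (Matrix.of y)) k i * (Matrix.of y * regInv δ (Matrix.of y)) k a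
          + (Matrix.of y * regInv δ (Matrix.of y) * (Matrix.of y).transpose) k k
            * regInv δ (Matrix.of y) i a)) ∂(gaussianMatrix κ ι) := by
  refine integral_mul_gaussianMatrix k i (C := δ⁻¹ + 1)
    (C' := δ⁻¹ + ((δ⁻¹ + 1) * (δ⁻¹ + 1) + Fintype.card ι * δ⁻¹))
    (measurable_mul_regInv δ k a) ?_ (fun y => abs_mul_regInv_le hδ _ _ _) (fun y => ?_)
    (fun y => hasDerivAt_entry_mul_regInv hδ y k i a)
  · exact (measurable_regInv δ i a).sub (((measurable_mul_regInv δ k i).mul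
      (measurable_mul_regInv δ k a)).add ((measurable_hat_diag δ k).mul (measurable_regInv δ i a)))
  · refine (abs_sub _ _).trans (add_le_add (abs_regInv_le hδ _ _ _) ((abs_add_le _ _).trans ?_))
    rw [abs_mul, abs_mul]
    gcongr
    · exact abs_mul_regInv_le hδ _ _ _
    · exact abs_mul_regInv_le hδ _ _ _
    · exact abs_hat_diag_le hδ _ _
    · exact abs_regInv_le hδ _ _ _

/-- The expectation of the regularized inverse Gram matrix of a Gaussian matrix, up to terms which
vanish with the regularization. -/
theorem integral_regInv {δ : ℝ} (hδ : 0 < δ) (i a : ι) :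
    ∫ y, (((Fintype.card κ : ℝ) - Fintype.card ι - 1) * regInv δ (Matrix.of y) i a
        + δ * regInv δ (Matrix.of y) i a
        + δ * (regInv δ (Matrix.of y) * regInv δ (Matrix.of y)) i a
        + δ * (regInv δ (Matrix.of y)).trace * regInv δ (Matrix.of y) i a) ∂(gaussianMatrix κ ι)
      = (1 : Matrix ι ι ℝ) i a := by
  classical
  have hA : Integrable (fun y : κ → ι → ℝ => regInv δ (Matrix.of y) i a) (gaussianMatrix κ ι) :=
    integrable_of_measurable_bound (measurable_regInv δ i a) (fun y => abs_regInv_le hδ _ _ _)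
  have hlhs : ∀ k : κ, Integrable (fun y : κ → ι → ℝ =>
      (Matrix.of y * regInv δ (Matrix.of y)) k a * y k i) (gaussianMatrix κ ι) := fun k =>
    integrable_mul_of_bound (integrable_comp_eval (i := k)
        (μ := fun _ : κ => Measure.pi fun _ : ι => gaussianReal 0 1) (f := fun v : ι → ℝ => v i)
        (integrable_eval (IsGaussian.integrable_id (μ := gaussianReal 0 1))))
      (measurable_mul_regInv δ k a).aestronglyMeasurable (fun y => abs_mul_regInv_le hδ _ _ _)
  have hrhs : ∀ k : κ, Integrable (fun y : κ → ι → ℝ => regInv δ (Matrix.of y) i a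
        - ((Matrix.of y * regInv δ (Matrix.of y)) k i * (Matrix.of y * regInv δ (Matrix.of y)) k a
          + (Matrix.of y * regInv δ (Matrix.of y) * (Matrix.of y).transpose) k k
            * regInv δ (Matrix.of y) i a)) (gaussianMatrix κ ι) := fun k => by
    refine hA.sub (Integrable.add ?_ ?_)
    · exact integrable_mul_of_bound (integrable_of_measurable_bound (measurable_mul_regInv δ k a)
        (fun y => abs_mul_regInv_le hδ _ _ _)) (measurable_mul_regInv δ k i).aestronglyMeasurable
        (fun y => abs_mul_regInv_le hδ _ _ _)
    · exact integrable_mul_of_bound hA (measurable_hat_diag δ k).aestronglyMeasurable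
        (fun y => abs_hat_diag_le hδ _ _)
  have hsum := Finset.sum_congr rfl fun k (_ : k ∈ (Finset.univ : Finset κ)) =>
    integral_mul_regInv_mul (κ := κ) hδ k i a
  rw [← integral_finsetSum _ fun k _ => hlhs k, ← integral_finsetSum _ fun k _ => hrhs k] at hsum
  -- Summed over k, the left side of Stein's identity is the entry of YᵀYA = 1 - δA.
  have hL : ∀ y : κ → ι → ℝ, ∑ k, (Matrix.of y * regInv δ (Matrix.of y)) k a * y k i
      = (1 : Matrix ι ι ℝ) i a - δ * regInv δ (Matrix.of y) i a := fun y => by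
    have h := congrFun (congrFun (gram_mul_regInv hδ (Matrix.of y)) i) a
    rw [Matrix.mul_apply, Matrix.sub_apply, Matrix.smul_apply, smul_eq_mul] at h
    rw [← h]
    exact Finset.sum_congr rfl fun k _ => by rw [mul_comm]; rfl
  -- On the right, the products sum to (A - δA²)ᵢₐ by `regInv_eq` and the hat diagonals to card ι -
  -- δ tr A by `trace_hat`; hence the factor card κ - card ι - 1.
  have hR : ∀ y : κ → ι → ℝ, ∑ k, (regInv δ (Matrix.of y) i a
        - ((Matrix.of y * regInv δ (Matrix.of y)) k i * (Matrix.of y * regInv δ (Matrix.of y)) k a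
          + (Matrix.of y * regInv δ (Matrix.of y) * (Matrix.of y).transpose) k k
            * regInv δ (Matrix.of y) i a))
      = (((Fintype.card κ : ℝ) - Fintype.card ι - 1) * regInv δ (Matrix.of y) i a
        + δ * (regInv δ (Matrix.of y) * regInv δ (Matrix.of y)) i a
        + δ * (regInv δ (Matrix.of y)).trace * regInv δ (Matrix.of y) i a) := fun y => by
    have h := congrFun (congrFun (regInv_eq hδ (Matrix.of y)) i) a
    rw [Matrix.mul_apply, Matrix.sub_apply, Matrix.smul_apply, smul_eq_mul] at h
    simp only [Matrix.transpose_apply] at h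
    rw [Finset.sum_sub_distrib, Finset.sum_add_distrib, ← Finset.sum_mul, trace_hat hδ, h]
    simp only [Finset.sum_const, Finset.card_univ, nsmul_eq_mul]
    ring
  simp only [hL, hR] at hsum
  have hRi : Integrable (fun y : κ → ι → ℝ =>
      ((Fintype.card κ : ℝ) - Fintype.card ι - 1) * regInv δ (Matrix.of y) i a
        + δ * (regInv δ (Matrix.of y) * regInv δ (Matrix.of y)) i a
        + δ * (regInv δ (Matrix.of y)).trace * regInv δ (Matrix.of y) i a)
      (gaussianMatrix κ ι) := by
    simp only [← hR]
    exact integrable_finsetSum _ fun k _ => hrhs k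
  rw [integral_sub (integrable_const _) (hA.const_mul δ)] at hsum
  simp only [integral_const, probReal_univ, one_smul] at hsum
  rw [← sub_add_cancel ((1 : Matrix ι ι ℝ) i a) (∫ y, δ * regInv δ (Matrix.of y) i a
    ∂(gaussianMatrix κ ι)), hsum, ← integral_add hRi (hA.const_mul δ)]
  exact integral_congr_ae (ae_of_all _ fun y => by simp only; ring)

end

/-! ### Quadratic forms: comparison of the regularized and the true inverse. -/

section

variable {κ ι : Type*} [Fintype κ] [Fintype ι]

theorem mulVec_dotProduct_self_le (M : Matrix κ ι ℝ) (v : ι → ℝ) :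
    M.mulVec v ⬝ᵥ M.mulVec v ≤ (∑ i, ∑ k, M k i ^ 2) * (v ⬝ᵥ v) := by
  rw [Finset.sum_comm, Finset.sum_mul]
  refine Finset.sum_le_sum fun k _ => ?_
  have := Finset.sum_mul_sq_le_sq_mul_sq Finset.univ (M k) v
  simp only [Matrix.mulVec, dotProduct, ← sq] at this ⊢
  exact this

theorem dotProduct_transpose_mul_mulVec (M : Matrix κ ι ℝ) (x y : ι → ℝ) :
    x ⬝ᵥ (M.transpose * M).mulVec y = M.mulVec x ⬝ᵥ M.mulVec y := by
  rw [← Matrix.mulVec_mulVec, Matrix.dotProduct_mulVec, Matrix.vecMul_transpose]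

theorem dotProduct_self_mul_mulVec {A : Matrix ι ι ℝ} (hA : A.transpose = A) (x y : ι → ℝ) :
    x ⬝ᵥ (A * A).mulVec y = A.mulVec x ⬝ᵥ A.mulVec y := by
  conv_lhs => rw [← hA]
  conv_lhs => enter [2, 1, 2]; rw [hA]
  exact dotProduct_transpose_mul_mulVec A x y

theorem dotProduct_self_nonneg_of_real (v : ι → ℝ) : 0 ≤ v ⬝ᵥ v :=
  Finset.sum_nonneg fun i _ => mul_self_nonneg (v i)

variable [DecidableEq ι]

theorem regInv_quadratic {δ : ℝ} (hδ : 0 < δ) (Y : Matrix κ ι ℝ) (x : ι → ℝ) :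
    x ⬝ᵥ (regInv δ Y).mulVec x
      = (Y * regInv δ Y).mulVec x ⬝ᵥ (Y * regInv δ Y).mulVec x
        + δ * ((regInv δ Y).mulVec x ⬝ᵥ (regInv δ Y).mulVec x) := by
  rw [← dotProduct_transpose_mul_mulVec, regInv_eq hδ,
    ← dotProduct_self_mul_mulVec (transpose_regInv δ Y), Matrix.sub_mulVec, Matrix.smul_mulVec,
    dotProduct_sub, dotProduct_smul, smul_eq_mul]
  ring

theorem regInv_quadratic_nonneg {δ : ℝ} (hδ : 0 < δ) (Y : Matrix κ ι ℝ) (x : ι → ℝ) :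
    0 ≤ x ⬝ᵥ (regInv δ Y).mulVec x := by
  rw [regInv_quadratic hδ]
  exact add_nonneg (Finset.sum_nonneg fun i _ => mul_self_nonneg _)
    (mul_nonneg hδ.le (dotProduct_self_nonneg_of_real _))

theorem mul_regInv_mulVec_sq_le {δ : ℝ} (hδ : 0 < δ) (Y : Matrix κ ι ℝ) (x : ι → ℝ) :
    δ * ((regInv δ Y).mulVec x ⬝ᵥ (regInv δ Y).mulVec x) ≤ x ⬝ᵥ (regInv δ Y).mulVec x := by
  conv_rhs => rw [regInv_quadratic hδ]
  exact le_add_of_nonneg_left (Finset.sum_nonneg fun i _ => mul_self_nonneg _)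

theorem mul_trace_regInv_le {δ : ℝ} (hδ : 0 < δ) (Y : Matrix κ ι ℝ) :
    δ * (regInv δ Y).trace ≤ Fintype.card ι := by
  have h : ∑ i, regInv δ Y i i ≤ ∑ _i : ι, δ⁻¹ :=
    Finset.sum_le_sum fun i _ => regInv_diag_le hδ Y i
  simp only [Finset.sum_const, Finset.card_univ, nsmul_eq_mul] at h
  calc δ * (regInv δ Y).trace ≤ δ * (Fintype.card ι * δ⁻¹) := by
        exact mul_le_mul_of_nonneg_left h hδ.le
    _ = Fintype.card ι := by field_simp

/-- A null vector of YᵀY is an eigenvector of A with eigenvalue δ⁻¹, and the trace of A dominates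
its quadratic form on unit vectors. This makes singularity of YᵀY costly in expectation. -/
theorem one_le_mul_trace_regInv {δ : ℝ} (hδ : 0 < δ) {Y : Matrix κ ι ℝ}
    (hY : (Y.transpose * Y).det = 0) : 1 ≤ δ * (regInv δ Y).trace := by
  obtain ⟨v, hv, hYv⟩ := Matrix.exists_mulVec_eq_zero_iff.2 hY
  have hpos : 0 < v ⬝ᵥ v :=
    lt_of_le_of_ne (dotProduct_self_nonneg_of_real v) fun h => hv (dotProduct_self_eq_zero.1 h.symm)
  have hAv : δ • (regInv δ Y).mulVec v = v := by
    have h : (regInv δ Y).mulVec ((Y.transpose * Y + δ • (1 : Matrix ι ι ℝ)).mulVec v) = v := by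
      rw [Matrix.mulVec_mulVec, regInv, Matrix.nonsing_inv_mul _ (isUnit_det_gram_add hδ Y),
        Matrix.one_mulVec]
    rwa [Matrix.add_mulVec, hYv, zero_add, Matrix.smul_mulVec, Matrix.one_mulVec,
      Matrix.mulVec_smul] at h
  have hq : v ⬝ᵥ v = δ * (v ⬝ᵥ (regInv δ Y).mulVec v) := by
    rw [← smul_eq_mul, ← dotProduct_smul, hAv]
  have htr : (regInv δ Y).trace
      = ∑ i, ∑ k, (Y * regInv δ Y) k i ^ 2 + δ * ∑ i, ∑ a, regInv δ Y a i ^ 2 := by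
    rw [Matrix.trace, Finset.mul_sum, ← Finset.sum_add_distrib]
    refine Finset.sum_congr rfl fun i _ => ?_
    rw [Matrix.diag_apply, regInv_diag hδ]
    simp only [regInv_apply_symm δ Y i]
  have hle : v ⬝ᵥ (regInv δ Y).mulVec v ≤ (regInv δ Y).trace * (v ⬝ᵥ v) := by
    rw [regInv_quadratic hδ, htr, add_mul, mul_assoc]
    exact add_le_add (mulVec_dotProduct_self_le _ _)
      (mul_le_mul_of_nonneg_left (mulVec_dotProduct_self_le _ _) hδ.le)
  have h := mul_le_mul_of_nonneg_left hle hδ.le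
  rw [← hq, ← mul_assoc] at h
  exact (le_mul_iff_one_le_left hpos).1 h

/-- With B = (YᵀY)⁻¹, iterating the resolvent identity on both sides gives B = A + δA² + δ²ABA,
where the last two terms are positive semidefinite. -/
theorem regInv_quadratic_le {δ : ℝ} (hδ : 0 < δ) {Y : Matrix κ ι ℝ}
    (hY : (Y.transpose * Y).det ≠ 0) (x : ι → ℝ) :
    x ⬝ᵥ (regInv δ Y).mulVec x ≤ x ⬝ᵥ (Y.transpose * Y)⁻¹.mulVec x := by
  set A := regInv δ Y with hA
  set B := (Y.transpose * Y)⁻¹ with hB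
  have hAt : A.transpose = A := transpose_regInv δ Y
  have hBt : B.transpose = B := by
    rw [hB, Matrix.transpose_nonsing_inv, Matrix.transpose_mul, Matrix.transpose_transpose]
  have h1 : B = A + δ • (B * A) := by
    have h := gram_mul_regInv hδ Y
    rw [← Matrix.mul_assoc] at h
    have h2 : B * (Y.transpose * Y * A) = A := by
      rw [← Matrix.mul_assoc, hB, Matrix.nonsing_inv_mul _ hY.isUnit, Matrix.one_mul]
    rw [h, Matrix.mul_sub, Matrix.mul_one, Matrix.mul_smul] at h2
    rw [← hA] at h2
    conv_rhs => lhs; rw [← h2]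
    rw [sub_add_cancel]
  have h2 : B = A + δ • (A * B) := by
    have := congrArg Matrix.transpose h1
    rwa [Matrix.transpose_add, Matrix.transpose_smul, Matrix.transpose_mul, hAt, hBt] at this
  have h3 : B = A + δ • (A * A) + δ ^ 2 • (A * B * A) := by
    conv_lhs => rw [h1]
    conv_lhs => rw [h2]
    rw [Matrix.add_mul, Matrix.smul_mul, smul_add, smul_smul, ← sq δ, add_assoc]
  have hBpos : B.PosSemidef := by
    have h := Matrix.posSemidef_conjTranspose_mul_self Y
    rw [Matrix.conjTranspose_eq_transpose_of_trivial] at h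
    exact h.inv
  have h4 : 0 ≤ x ⬝ᵥ (A * B * A).mulVec x := by
    have := (hBpos.conjTranspose_mul_mul_same A).dotProduct_mulVec_nonneg x
    rwa [Matrix.conjTranspose_eq_transpose_of_trivial, hAt, star_trivial] at this
  have h5 : 0 ≤ x ⬝ᵥ (A * A).mulVec x := by
    rw [dotProduct_self_mul_mulVec hAt]
    exact dotProduct_self_nonneg_of_real _
  rw [h3, Matrix.add_mulVec, Matrix.add_mulVec, Matrix.smul_mulVec, Matrix.smul_mulVec,
    dotProduct_add, dotProduct_add, dotProduct_smul, dotProduct_smul, smul_eq_mul, smul_eq_mul]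
  have := mul_nonneg hδ.le h5
  have := mul_nonneg (sq_nonneg δ) h4
  linarith

open Filter Topology in
theorem tendsto_regInv {Y : Matrix κ ι ℝ} (hY : (Y.transpose * Y).det ≠ 0) (i a : ι) :
    Tendsto (fun δ : ℝ => regInv δ Y i a) (𝓝 0) (𝓝 ((Y.transpose * Y)⁻¹ i a)) := by
  have hc : Continuous fun δ : ℝ => Y.transpose * Y + δ • (1 : Matrix ι ι ℝ) := by fun_prop
  have h0 : Y.transpose * Y + (0 : ℝ) • (1 : Matrix ι ι ℝ) = Y.transpose * Y := by simp
  simp only [regInv, inv_apply_eq]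
  have h1 : Tendsto (fun δ : ℝ => (Y.transpose * Y + δ • (1 : Matrix ι ι ℝ)).det) (𝓝 0)
      (𝓝 (Y.transpose * Y).det) := by
    have := hc.matrix_det.tendsto 0
    rwa [h0] at this
  have h2 : Tendsto (fun δ : ℝ => (Y.transpose * Y + δ • (1 : Matrix ι ι ℝ)).adjugate i a) (𝓝 0)
      (𝓝 ((Y.transpose * Y).adjugate i a)) := by
    have := (hc.matrix_adjugate.matrix_elem i a).tendsto 0
    rwa [h0] at this
  exact (h1.inv₀ hY).mul h2

end

/-! ### The limit δ → 0: mean of the inverse Gram matrix. -/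

theorem dotProduct_mulVec_eq_sum {ι : Type*} [Fintype ι] (M : Matrix ι ι ℝ) (x y : ι → ℝ) :
    x ⬝ᵥ M.mulVec y = ∑ i, ∑ a, x i * y a * M i a := by
  simp only [dotProduct, Matrix.mulVec, Finset.mul_sum]
  exact Finset.sum_congr rfl fun i _ => Finset.sum_congr rfl fun a _ => by ring

theorem integral_dotProduct_mulVec {α ι : Type*} [MeasurableSpace α] [Fintype ι] {μ : Measure α}
    {M : α → Matrix ι ι ℝ} (hM : ∀ i a, Integrable (fun y => M y i a) μ) (x y : ι → ℝ) :
    ∫ ω, x ⬝ᵥ (M ω).mulVec y ∂μ = x ⬝ᵥ (Matrix.of fun i a => ∫ ω, M ω i a ∂μ).mulVec y := by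
  simp only [dotProduct_mulVec_eq_sum, Matrix.of_apply]
  rw [integral_finsetSum _ fun i _ => integrable_finsetSum _ fun a _ => (hM i a).const_mul _]
  refine Finset.sum_congr rfl fun i _ => ?_
  rw [integral_finsetSum _ fun a _ => (hM i a).const_mul _]
  exact Finset.sum_congr rfl fun a _ => integral_const_mul _ _

theorem measurable_dotProduct_mulVec {α ι : Type*} [MeasurableSpace α] [Fintype ι]
    {M : α → Matrix ι ι ℝ} (hM : ∀ i a, Measurable fun y => M y i a) (x y : ι → ℝ) :
    Measurable fun ω => x ⬝ᵥ (M ω).mulVec y := by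
  simp only [dotProduct_mulVec_eq_sum]
  exact Finset.measurable_sum _ fun i _ => Finset.measurable_sum _ fun a _ =>
    (hM i a).const_mul _

section

variable {κ ι : Type*} [Fintype κ] [Fintype ι] [DecidableEq ι]

theorem measurable_trace_regInv (δ : ℝ) :
    Measurable fun y : κ → ι → ℝ => (regInv δ (Matrix.of y)).trace :=
  Finset.measurable_sum _ fun i _ => measurable_regInv δ i i

theorem measurable_regInv_mul_self (δ : ℝ) (i a : ι) :
    Measurable fun y : κ → ι → ℝ => (regInv δ (Matrix.of y) * regInv δ (Matrix.of y)) i a :=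
  Finset.measurable_sum _ fun b _ => (measurable_regInv δ i b).mul (measurable_regInv δ b a)

/-- The random matrix whose expectation is the identity. -/
noncomputable def steinMatrix (δ : ℝ) (Y : Matrix κ ι ℝ) : Matrix ι ι ℝ :=
  ((Fintype.card κ : ℝ) - Fintype.card ι - 1) • regInv δ Y + δ • regInv δ Y
    + δ • (regInv δ Y * regInv δ Y) + (δ * (regInv δ Y).trace) • regInv δ Y

theorem measurable_steinMatrix (δ : ℝ) (i a : ι) :
    Measurable fun y : κ → ι → ℝ => steinMatrix δ (Matrix.of y) i a := by
  have h1 := measurable_regInv (κ := κ) δ i a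
  have h2 := measurable_regInv_mul_self (κ := κ) δ i a
  have h3 := measurable_trace_regInv (κ := κ) (ι := ι) δ
  exact (((h1.const_mul _).add (h1.const_mul _)).add (h2.const_mul _)).add ((h3.const_mul δ).mul h1)

theorem integrable_steinMatrix {δ : ℝ} (hδ : 0 < δ) (i a : ι) :
    Integrable (fun y : κ → ι → ℝ => steinMatrix δ (Matrix.of y) i a) (gaussianMatrix κ ι) := by
  have hA : ∀ b c, Integrable (fun y : κ → ι → ℝ => regInv δ (Matrix.of y) b c)
      (gaussianMatrix κ ι) := fun b c =>
    integrable_of_measurable_bound (measurable_regInv δ b c) (fun y => abs_regInv_le hδ _ _ _)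
  refine Integrable.add (Integrable.add (Integrable.add ((hA i a).const_mul _)
    ((hA i a).const_mul _)) (Integrable.const_mul ?_ _)) ?_
  · exact integrable_finsetSum _ fun b _ => integrable_mul_of_bound (hA b a)
      (measurable_regInv δ i b).aestronglyMeasurable (fun y => abs_regInv_le hδ _ _ _)
  · refine integrable_mul_of_bound (hA i a)
      ((measurable_trace_regInv δ).const_mul δ).aestronglyMeasurable (C := Fintype.card ι)
      fun y => ?_
    rw [abs_of_nonneg (mul_nonneg hδ.le (regInv_trace_nonneg hδ _))]
    exact mul_trace_regInv_le hδ _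

theorem integral_steinMatrix_quadratic {δ : ℝ} (hδ : 0 < δ) (x : ι → ℝ) :
    ∫ y, x ⬝ᵥ (steinMatrix δ (Matrix.of y)).mulVec x ∂(gaussianMatrix κ ι) = x ⬝ᵥ x := by
  rw [integral_dotProduct_mulVec fun i a => integrable_steinMatrix hδ i a]
  have h : (Matrix.of fun i a => ∫ y, steinMatrix δ (Matrix.of y) i a ∂(gaussianMatrix κ ι))
      = (1 : Matrix ι ι ℝ) := by
    ext i a
    rw [← integral_regInv (κ := κ) hδ]
    rfl
  rw [h, Matrix.one_mulVec]

theorem steinMatrix_quadratic (δ : ℝ) (Y : Matrix κ ι ℝ) (x : ι → ℝ) :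
    x ⬝ᵥ (steinMatrix δ Y).mulVec x
      = ((Fintype.card κ : ℝ) - Fintype.card ι - 1) * (x ⬝ᵥ (regInv δ Y).mulVec x)
        + δ * (x ⬝ᵥ (regInv δ Y).mulVec x)
        + δ * ((regInv δ Y).mulVec x ⬝ᵥ (regInv δ Y).mulVec x)
        + δ * (regInv δ Y).trace * (x ⬝ᵥ (regInv δ Y).mulVec x) := by
  rw [← dotProduct_self_mul_mulVec (transpose_regInv δ Y)]
  simp only [steinMatrix, Matrix.add_mulVec, Matrix.smul_mulVec, dotProduct_add, dotProduct_smul,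
    smul_eq_mul]

theorem mul_regInv_quadratic_le {δ : ℝ} (hδ : 0 < δ) (Y : Matrix κ ι ℝ) (x : ι → ℝ) :
    ((Fintype.card κ : ℝ) - Fintype.card ι - 1) * (x ⬝ᵥ (regInv δ Y).mulVec x)
      ≤ x ⬝ᵥ (steinMatrix δ Y).mulVec x := by
  rw [steinMatrix_quadratic]
  have h1 := regInv_quadratic_nonneg hδ Y x
  have h2 := mul_nonneg hδ.le h1
  have h3 := mul_nonneg hδ.le (dotProduct_self_nonneg_of_real ((regInv δ Y).mulVec x))
  have h4 := mul_nonneg (mul_nonneg hδ.le (regInv_trace_nonneg hδ Y)) h1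
  linarith

theorem integrable_regInv_quadratic {δ : ℝ} (hδ : 0 < δ) (x : ι → ℝ) :
    Integrable (fun y : κ → ι → ℝ => x ⬝ᵥ (regInv δ (Matrix.of y)).mulVec x)
      (gaussianMatrix κ ι) := by
  simp only [dotProduct_mulVec_eq_sum]
  exact integrable_finsetSum _ fun b _ => integrable_finsetSum _ fun c _ =>
    (integrable_of_measurable_bound (measurable_regInv δ b c)
      (fun y => abs_regInv_le hδ _ _ _)).const_mul _

/-- Dropping the nonnegative terms of the Stein matrix leaves a bound independent of δ; both almost
sure invertibility and Fatou's lemma rest on it. -/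
theorem integral_regInv_quadratic_le (hc : (Fintype.card ι : ℝ) + 1 < Fintype.card κ) {δ : ℝ}
    (hδ : 0 < δ) (x : ι → ℝ) :
    ∫ y, x ⬝ᵥ (regInv δ (Matrix.of y)).mulVec x ∂(gaussianMatrix κ ι)
      ≤ ((Fintype.card κ : ℝ) - Fintype.card ι - 1)⁻¹ * (x ⬝ᵥ x) := by
  have hc' : (0 : ℝ) < (Fintype.card κ : ℝ) - Fintype.card ι - 1 := by linarith
  rw [← integral_steinMatrix_quadratic (κ := κ) hδ x, ← div_eq_inv_mul, le_div_iff₀' hc',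
    ← integral_const_mul]
  refine integral_mono ((integrable_regInv_quadratic hδ x).const_mul _) ?_
    fun y => mul_regInv_quadratic_le hδ (Matrix.of y) x
  simp only [dotProduct_mulVec_eq_sum]
  exact integrable_finsetSum _ fun b _ => integrable_finsetSum _ fun c _ =>
    (integrable_steinMatrix hδ b c).const_mul _

/-- The Gram matrix of a Gaussian matrix is almost surely invertible. -/
theorem ae_det_gram_ne_zero (hc : (Fintype.card ι : ℝ) + 1 < Fintype.card κ) :
    ∀ᵐ y ∂(gaussianMatrix κ ι), ((Matrix.of y).transpose * Matrix.of y).det ≠ 0 := by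
  have hdet : Measurable fun y : κ → ι → ℝ => ((Matrix.of y).transpose * Matrix.of y).det := by
    have h : Continuous fun y : κ → ι → ℝ => (Matrix.of y : Matrix κ ι ℝ) := continuous_id
    exact (h.matrix_transpose.matrix_mul h).matrix_det.measurable
  have hs : MeasurableSet {y : κ → ι → ℝ | ((Matrix.of y).transpose * Matrix.of y).det = 0} :=
    hdet (measurableSet_singleton 0)
  -- A bound on E tr A that does not depend on δ. Since δ tr A ≥ 1 on the singular set, that set has
  -- probability at most δK for every δ > 0.
  set K : ℝ := ∑ i : ι, ((Fintype.card κ : ℝ) - Fintype.card ι - 1)⁻¹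
    * (Pi.single i (1 : ℝ) ⬝ᵥ Pi.single i (1 : ℝ))
  have hbound : ∀ δ : ℝ, 0 < δ → (gaussianMatrix κ ι).real
      {y | ((Matrix.of y).transpose * Matrix.of y).det = 0} ≤ δ * K := by
    intro δ hδ
    have htr : ∀ y : κ → ι → ℝ, (regInv δ (Matrix.of y)).trace
        = ∑ i, Pi.single i (1 : ℝ) ⬝ᵥ (regInv δ (Matrix.of y)).mulVec (Pi.single i 1) := by
      intro y
      simp [Matrix.trace]
    have hint : Integrable (fun y : κ → ι → ℝ => (regInv δ (Matrix.of y)).trace)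
        (gaussianMatrix κ ι) := by
      simp only [htr]
      exact integrable_finsetSum _ fun i _ => integrable_regInv_quadratic hδ _
    have hle : ∫ y, (regInv δ (Matrix.of y)).trace ∂(gaussianMatrix κ ι) ≤ K := by
      simp only [htr]
      rw [integral_finsetSum _ fun i _ => integrable_regInv_quadratic hδ _]
      exact Finset.sum_le_sum fun i _ => integral_regInv_quadratic_le hc hδ _
    rw [← integral_indicator_one hs]
    refine le_trans ?_ (mul_le_mul_of_nonneg_left hle hδ.le)
    rw [← integral_const_mul]
    refine integral_mono ((integrable_const _).indicator hs) (hint.const_mul δ) fun y => ?_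
    by_cases hy : ((Matrix.of y).transpose * Matrix.of y).det = 0
    · rw [Set.indicator_of_mem (by exact hy)]
      exact one_le_mul_trace_regInv hδ hy
    · rw [Set.indicator_of_notMem (by exact hy)]
      exact mul_nonneg hδ.le (regInv_trace_nonneg hδ _)
  have hzero : (gaussianMatrix κ ι).real
      {y | ((Matrix.of y).transpose * Matrix.of y).det = 0} ≤ 0 := by
    have hlim : Filter.Tendsto (fun δ : ℝ => δ * K) (nhdsWithin 0 (Set.Ioi 0)) (nhds 0) := by
      have : Continuous fun δ : ℝ => δ * K := by fun_prop
      simpa using (this.tendsto 0).mono_left nhdsWithin_le_nhds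
    exact ge_of_tendsto hlim (Filter.eventually_of_mem self_mem_nhdsWithin hbound)
  rw [ae_iff]
  simp only [not_not]
  exact (measureReal_eq_zero_iff).1 (le_antisymm hzero measureReal_nonneg)

theorem measurable_gram_inv (i a : ι) :
    Measurable fun y : κ → ι → ℝ => ((Matrix.of y).transpose * Matrix.of y)⁻¹ i a := by
  simpa [regInv] using measurable_regInv (κ := κ) 0 i a

open Filter Topology in
theorem tendsto_regInv_quadratic {Y : Matrix κ ι ℝ} (hY : (Y.transpose * Y).det ≠ 0) (x : ι → ℝ) :
    Tendsto (fun δ : ℝ => x ⬝ᵥ (regInv δ Y).mulVec x) (𝓝 0)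
      (𝓝 (x ⬝ᵥ (Y.transpose * Y)⁻¹.mulVec x)) := by
  simp only [dotProduct_mulVec_eq_sum]
  exact tendsto_finsetSum _ fun i _ => tendsto_finsetSum _ fun a _ =>
    (tendsto_regInv hY i a).const_mul _

open Filter Topology in
theorem tendsto_steinMatrix_quadratic {Y : Matrix κ ι ℝ} (hY : (Y.transpose * Y).det ≠ 0)
    (x : ι → ℝ) :
    Tendsto (fun δ : ℝ => x ⬝ᵥ (steinMatrix δ Y).mulVec x) (𝓝 0)
      (𝓝 (((Fintype.card κ : ℝ) - Fintype.card ι - 1)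
        * (x ⬝ᵥ (Y.transpose * Y)⁻¹.mulVec x))) := by
  have hq := tendsto_regInv_quadratic hY x
  have hid : Tendsto (fun δ : ℝ => δ) (𝓝 0) (𝓝 0) := tendsto_id
  have htr : Tendsto (fun δ : ℝ => (regInv δ Y).trace) (𝓝 0) (𝓝 (Y.transpose * Y)⁻¹.trace) :=
    tendsto_finsetSum _ fun i _ => tendsto_regInv hY i i
  have hsq : Tendsto (fun δ : ℝ => (regInv δ Y).mulVec x ⬝ᵥ (regInv δ Y).mulVec x) (𝓝 0)
      (𝓝 ((Y.transpose * Y)⁻¹.mulVec x ⬝ᵥ (Y.transpose * Y)⁻¹.mulVec x)) := by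
    have h : ∀ i, Tendsto (fun δ : ℝ => (regInv δ Y).mulVec x i) (𝓝 0)
        (𝓝 ((Y.transpose * Y)⁻¹.mulVec x i)) := fun i =>
      tendsto_finsetSum _ fun a _ => (tendsto_regInv hY i a).mul_const _
    exact tendsto_finsetSum _ fun i _ => (h i).mul (h i)
  simp only [steinMatrix_quadratic]
  have := (((hq.const_mul ((Fintype.card κ : ℝ) - Fintype.card ι - 1)).add (hid.mul hq)).add
    (hid.mul hsq)).add ((hid.mul htr).mul hq)
  simpa using this

/-- The dominating function for δ → 0. Each of δq, δ|Ax|² and δ tr(A) q is at most q, q and card ι ·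
q, where q = xᵀAx, so the coefficients add up to card κ + 1. -/
theorem abs_steinMatrix_quadratic_le (hc : (Fintype.card ι : ℝ) + 1 < Fintype.card κ) {δ : ℝ}
    (hδ : 0 < δ) (hδ1 : δ ≤ 1) {Y : Matrix κ ι ℝ} (hY : (Y.transpose * Y).det ≠ 0) (x : ι → ℝ) :
    |x ⬝ᵥ (steinMatrix δ Y).mulVec x|
      ≤ ((Fintype.card κ : ℝ) + 1) * (x ⬝ᵥ (Y.transpose * Y)⁻¹.mulVec x) := by
  have hq := regInv_quadratic_le hδ hY x
  have h1 := regInv_quadratic_nonneg hδ Y x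
  have h2 := mul_nonneg hδ.le h1
  have h4 := mul_le_mul_of_nonneg_right (mul_trace_regInv_le hδ Y) h1
  have h5 := mul_regInv_mulVec_sq_le hδ Y x
  have h6 := mul_le_mul_of_nonneg_right hδ1 h1
  have h7 := mul_regInv_quadratic_le hδ Y x
  have hc' : (0 : ℝ) < (Fintype.card κ : ℝ) - Fintype.card ι - 1 := by linarith
  rw [abs_of_nonneg ((mul_nonneg hc'.le h1).trans h7), steinMatrix_quadratic]
  refine le_trans ?_ (mul_le_mul_of_nonneg_left hq (by positivity))
  linarith

-- Fatou's lemma along δ = 1/(m+1): the regularized forms converge almost surely and their means are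
-- uniformly bounded.
open Filter Topology in
theorem integrable_gram_inv_quadratic (hc : (Fintype.card ι : ℝ) + 1 < Fintype.card κ)
    (x : ι → ℝ) :
    Integrable (fun y : κ → ι → ℝ => x ⬝ᵥ ((Matrix.of y).transpose * Matrix.of y)⁻¹.mulVec x)
      (gaussianMatrix κ ι) := by
  have hu : Tendsto (fun m : ℕ => 1 / ((m : ℝ) + 1)) atTop (𝓝 0) :=
    tendsto_one_div_add_atTop_nhds_zero_nat
  have hpos : ∀ m : ℕ, 0 < 1 / ((m : ℝ) + 1) := fun m => by positivity
  refine ⟨(measurable_dotProduct_mulVec measurable_gram_inv x x).aestronglyMeasurable, ?_⟩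
  have hae : ∀ᵐ y ∂(gaussianMatrix κ ι),
      ‖x ⬝ᵥ ((Matrix.of y).transpose * Matrix.of y)⁻¹.mulVec x‖ₑ
        = liminf (fun m : ℕ => ‖x ⬝ᵥ (regInv (1 / ((m : ℝ) + 1)) (Matrix.of y)).mulVec x‖ₑ)
          atTop := by
    filter_upwards [ae_det_gram_ne_zero hc] with y hy
    exact (((tendsto_regInv_quadratic hy x).comp hu).enorm.liminf_eq).symm
  rw [HasFiniteIntegral, lintegral_congr_ae hae]
  refine lt_of_le_of_lt (lintegral_liminf_le fun m => (measurable_dotProduct_mulVec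
    (measurable_regInv (1 / ((m : ℝ) + 1))) x x).enorm) ?_
  refine lt_of_le_of_lt (liminf_le_of_le (a := ENNReal.ofReal
    (((Fintype.card κ : ℝ) - Fintype.card ι - 1)⁻¹ * (x ⬝ᵥ x))) ?_ ?_) ENNReal.ofReal_lt_top
  · isBoundedDefault
  · intro b hb
    obtain ⟨m, hm⟩ := hb.exists
    refine hm.trans ?_
    have hnn : ∀ y : κ → ι → ℝ,
        0 ≤ x ⬝ᵥ (regInv (1 / ((m : ℝ) + 1)) (Matrix.of y)).mulVec x :=
      fun y => regInv_quadratic_nonneg (hpos m) _ x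
    simp only [Real.enorm_of_nonneg (hnn _)]
    rw [← ofReal_integral_eq_lintegral_ofReal (integrable_regInv_quadratic (hpos m) x)
      (ae_of_all _ hnn)]
    exact ENNReal.ofReal_le_ofReal (integral_regInv_quadratic_le hc (hpos m) x)

open Filter Topology in
/-- The expectation of the inverse Gram matrix of a Gaussian matrix, as a quadratic form. -/
theorem integral_gram_inv_quadratic (hc : (Fintype.card ι : ℝ) + 1 < Fintype.card κ)
    (x : ι → ℝ) :
    ((Fintype.card κ : ℝ) - Fintype.card ι - 1) *
      ∫ y, x ⬝ᵥ ((Matrix.of y).transpose * Matrix.of y)⁻¹.mulVec x ∂(gaussianMatrix κ ι)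
      = x ⬝ᵥ x := by
  have hu : Tendsto (fun m : ℕ => 1 / ((m : ℝ) + 1)) atTop (𝓝 0) :=
    tendsto_one_div_add_atTop_nhds_zero_nat
  have hpos : ∀ m : ℕ, 0 < 1 / ((m : ℝ) + 1) := fun m => by positivity
  have hle : ∀ m : ℕ, 1 / ((m : ℝ) + 1) ≤ 1 := fun m => by
    rw [div_le_one (by positivity)]
    linarith [(Nat.cast_nonneg m : (0 : ℝ) ≤ m)]
  have hlim := tendsto_integral_of_dominated_convergence (μ := gaussianMatrix κ ι)
    (F := fun (m : ℕ) y => x ⬝ᵥ (steinMatrix (1 / ((m : ℝ) + 1)) (Matrix.of y)).mulVec x)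
    (f := fun y => ((Fintype.card κ : ℝ) - Fintype.card ι - 1)
        * (x ⬝ᵥ ((Matrix.of y).transpose * Matrix.of y)⁻¹.mulVec x))
    (fun y => ((Fintype.card κ : ℝ) + 1)
        * (x ⬝ᵥ ((Matrix.of y).transpose * Matrix.of y)⁻¹.mulVec x))
    (fun m => (measurable_dotProduct_mulVec (measurable_steinMatrix _) x x).aestronglyMeasurable)
    ((integrable_gram_inv_quadratic hc x).const_mul _)
    (fun m => by
      filter_upwards [ae_det_gram_ne_zero hc] with y hy
      exact abs_steinMatrix_quadratic_le hc (hpos m) (hle m) hy x)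
    (by
      filter_upwards [ae_det_gram_ne_zero hc] with y hy
      exact (tendsto_steinMatrix_quadratic hy x).comp hu)
  rw [integral_const_mul] at hlim
  refine tendsto_nhds_unique hlim ?_
  simp only [integral_steinMatrix_quadratic (hpos _) x]
  exact tendsto_const_nhds

/-- Uses symmetry of (YᵀY)⁻¹. It carries the mean from quadratic to bilinear forms, which the
gradient bound needs coordinate by coordinate. -/
theorem gram_inv_polarization (Y : Matrix κ ι ℝ) (u v : ι → ℝ) :
    u ⬝ᵥ (Y.transpose * Y)⁻¹.mulVec v
      = ((u + v) ⬝ᵥ (Y.transpose * Y)⁻¹.mulVec (u + v)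
        - (u - v) ⬝ᵥ (Y.transpose * Y)⁻¹.mulVec (u - v)) / 4 := by
  have h : v ⬝ᵥ (Y.transpose * Y)⁻¹.mulVec u = u ⬝ᵥ (Y.transpose * Y)⁻¹.mulVec v := by
    rw [dotProduct_comm, ← Matrix.vecMul_transpose, Matrix.dotProduct_mulVec,
      Matrix.transpose_nonsing_inv, Matrix.transpose_mul, Matrix.transpose_transpose]
  simp only [Matrix.mulVec_add, Matrix.mulVec_sub, add_dotProduct, sub_dotProduct, dotProduct_add,
    dotProduct_sub, h]
  ring

/-- The expectation of the inverse Gram matrix of a Gaussian matrix, as a bilinear form. -/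
theorem integral_gram_inv_bilinear (hc : (Fintype.card ι : ℝ) + 1 < Fintype.card κ)
    (u v : ι → ℝ) :
    ∫ y, u ⬝ᵥ ((Matrix.of y).transpose * Matrix.of y)⁻¹.mulVec v ∂(gaussianMatrix κ ι)
      = ((Fintype.card κ : ℝ) - Fintype.card ι - 1)⁻¹ * (u ⬝ᵥ v) := by
  have hc' : (0 : ℝ) < (Fintype.card κ : ℝ) - Fintype.card ι - 1 := by linarith
  have h : ∀ x : ι → ℝ,
      ∫ y, x ⬝ᵥ ((Matrix.of y).transpose * Matrix.of y)⁻¹.mulVec x ∂(gaussianMatrix κ ι)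
        = ((Fintype.card κ : ℝ) - Fintype.card ι - 1)⁻¹ * (x ⬝ᵥ x) := fun x => by
    rw [← integral_gram_inv_quadratic hc x, inv_mul_cancel_left₀ hc'.ne']
  rw [integral_congr_ae (ae_of_all _ fun y => gram_inv_polarization (Matrix.of y) u v),
    integral_div, integral_sub (integrable_gram_inv_quadratic hc _)
    (integrable_gram_inv_quadratic hc _), h, h]
  simp only [add_dotProduct, sub_dotProduct, dotProduct_add, dotProduct_sub, dotProduct_comm v u]
  ring

end

/-! ### Whitening: from the Gaussian matrix to the empirical covariance. -/

section Ensemble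

open scoped MatrixOrder

variable {n N : ℕ} {Ω : Type*} [MeasurableSpace Ω] {P : Measure Ω}

theorem transpose_sqrt (S : Matrix (Fin n) (Fin n) ℝ) :
    (CFC.sqrt S).transpose = CFC.sqrt S := by
  have h : IsSelfAdjoint (CFC.sqrt S) := (CFC.sqrt_nonneg S).isSelfAdjoint
  rwa [IsSelfAdjoint, Matrix.star_eq_conjTranspose,
    Matrix.conjTranspose_eq_transpose_of_trivial] at h

theorem sqrt_mul_sqrt {S : Matrix (Fin n) (Fin n) ℝ} (hS : S.PosDef) :
    CFC.sqrt S * CFC.sqrt S = S :=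
  CFC.sqrt_mul_sqrt_self S hS.posSemidef.nonneg

theorem multivariateGaussian_eq_map (m : E n) (S : Matrix (Fin n) (Fin n) ℝ) :
    multivariateGaussian m S = (Measure.pi fun _ : Fin n => gaussianReal 0 1).map
      fun v => m + WithLp.toLp 2 ((CFC.sqrt S).mulVec v) := by
  rw [multivariateGaussian, ← map_pi_eq_stdGaussian, Measure.map_map (by fun_prop) (by fun_prop)]
  rfl

theorem measurable_affine (m : E n) (R : Matrix (Fin n) (Fin n) ℝ) :
    Measurable fun v : Fin n → ℝ => m + WithLp.toLp 2 (R.mulVec v) := by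
  have : Continuous fun v : Fin n → ℝ => R.mulVec v := continuous_const.matrix_mulVec continuous_id
  fun_prop

/-- The law of an ensemble of independent Gaussian draws is the image of a Gaussian matrix. -/
theorem map_ensemble_eq [IsProbabilityMeasure P] {m : E n} {S : Matrix (Fin n) (Fin n) ℝ}
    {z : Fin N → Ω → E n} (hz : ∀ k, Measurable (z k))
    (hlaw : ∀ k, P.map (z k) = multivariateGaussian m S) (hind : iIndepFun z P) :
    P.map (fun ω k => z k ω) = (gaussianMatrix (Fin N) (Fin n)).map
      fun y k => m + WithLp.toLp 2 ((CFC.sqrt S).mulVec (y k)) := by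
  rw [(iIndepFun_iff_map_fun_eq_pi_map fun k => (hz k).aemeasurable).1 hind]
  simp only [hlaw, multivariateGaussian_eq_map]
  rw [Measure.pi_map_pi fun _ => (measurable_affine m _).aemeasurable]

theorem empCov_affine (m : E n) (R : Matrix (Fin n) (Fin n) ℝ) (hR : R.transpose = R)
    (y : Fin N → Fin n → ℝ) :
    empCov m (fun k => m + WithLp.toLp 2 (R.mulVec (y k)))
      = ((N : ℝ) - 1)⁻¹ • (R * ((Matrix.of y).transpose * Matrix.of y) * R) := by
  have h1 : R * ((Matrix.of y).transpose * Matrix.of y) * R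
      = (Matrix.of y * R).transpose * (Matrix.of y * R) := by
    rw [Matrix.transpose_mul, hR]
    simp only [Matrix.mul_assoc]
  have h2 : ∀ k a, (Matrix.of y * R) k a = R.mulVec (y k) a := fun k a => by
    conv_rhs => rw [← hR, Matrix.mulVec_transpose]
    rfl
  rw [empCov, h1]
  congr 1
  ext a b
  rw [Matrix.sum_apply, Matrix.mul_apply]
  refine Finset.sum_congr rfl fun k _ => ?_
  rw [Matrix.transpose_apply, h2, h2, Matrix.vecMulVec_apply, add_sub_cancel_left]

/-- Writing the factor c⁻¹ as a scalar matrix lets the rule for inverses of products do everything,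
with no invertibility assumption on R or M. -/
theorem inv_smul_mul_mul {c : ℝ} (hc : c ≠ 0) (R M : Matrix (Fin n) (Fin n) ℝ) :
    (c⁻¹ • (R * M * R))⁻¹ = c • (R⁻¹ * M⁻¹ * R⁻¹) := by
  have h : (c⁻¹ • (R * M * R)) = (Matrix.scalar (Fin n) c⁻¹) * (R * M * R) := by
    ext a b; simp
  have h' : (Matrix.scalar (Fin n) c⁻¹)⁻¹ = Matrix.scalar (Fin n) c := by
    refine Matrix.inv_eq_left_inv ?_
    rw [← map_mul, mul_inv_cancel₀ hc, map_one]
  rw [h, Matrix.mul_inv_rev, Matrix.mul_inv_rev, Matrix.mul_inv_rev, h', ← Matrix.mul_assoc]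
  ext a b
  simp [mul_comm]

theorem bilinear_inv_empCov_affine (hN : ((N : ℝ) - 1) ≠ 0) (m : E n)
    (R : Matrix (Fin n) (Fin n) ℝ) (hR : R.transpose = R) (y : Fin N → Fin n → ℝ)
    (u v : Fin n → ℝ) :
    u ⬝ᵥ (empCov m (fun k => m + WithLp.toLp 2 (R.mulVec (y k))))⁻¹.mulVec v
      = ((N : ℝ) - 1) *
        (R⁻¹.mulVec u ⬝ᵥ ((Matrix.of y).transpose * Matrix.of y)⁻¹.mulVec (R⁻¹.mulVec v)) := by
  rw [empCov_affine m R hR, inv_smul_mul_mul hN, Matrix.smul_mulVec, dotProduct_smul, smul_eq_mul,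
    ← Matrix.mulVec_mulVec, ← Matrix.mulVec_mulVec, Matrix.dotProduct_mulVec u R⁻¹,
    ← Matrix.mulVec_transpose, Matrix.transpose_nonsing_inv, hR]

theorem measurable_empCov_apply (m : E n) (a b : Fin n) :
    Measurable fun z : Fin N → E n => empCov m z a b := by
  have h : ∀ z : Fin N → E n, empCov m z a b
      = ((N : ℝ) - 1)⁻¹ * ∑ k, (z k - m).ofLp a * (z k - m).ofLp b := fun z => by
    rw [empCov, Matrix.smul_apply, Matrix.sum_apply, smul_eq_mul]
    simp only [Matrix.vecMulVec_apply]
  simp only [h]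
  fun_prop

theorem measurable_inv_empCov_apply (m : E n) (a b : Fin n) :
    Measurable fun z : Fin N → E n => (empCov m z)⁻¹ a b :=
  measurable_inv_apply (fun a b => measurable_empCov_apply m a b) a b

/-- The expectation of the inverse empirical covariance of an ensemble of Gaussian draws. -/
theorem integral_bilinear_inv_empCov [IsProbabilityMeasure P] {m : E n}
    {S : Matrix (Fin n) (Fin n) ℝ} (hS : S.PosDef)
    {z : Fin N → Ω → E n} (hz : ∀ k, Measurable (z k))
    (hlaw : ∀ k, P.map (z k) = multivariateGaussian m S) (hind : iIndepFun z P)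
    (hN : (n : ℝ) + 1 < N) (u v : Fin n → ℝ) :
    ∫ ω, u ⬝ᵥ (empCov m (fun k => z k ω))⁻¹.mulVec v ∂P
      = (1 + (n : ℝ) / ((N : ℝ) - 1 - n)) * (u ⬝ᵥ S⁻¹.mulVec v) := by
  have hN1 : (N : ℝ) - 1 ≠ 0 := by
    have : (0 : ℝ) ≤ n := Nat.cast_nonneg n
    linarith
  have hc : (Fintype.card (Fin n) : ℝ) + 1 < Fintype.card (Fin N) := by simpa using hN
  have hmeas : Measurable fun w : Fin N → E n => u ⬝ᵥ (empCov m w)⁻¹.mulVec v :=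
    measurable_dotProduct_mulVec (fun a b => measurable_inv_empCov_apply m a b) u v
  have hzm : Measurable fun ω k => z k ω := measurable_pi_lambda _ hz
  have hT : Measurable fun (y : Fin N → Fin n → ℝ) k =>
      m + WithLp.toLp 2 ((CFC.sqrt S).mulVec (y k)) :=
    measurable_pi_lambda _ fun k => (measurable_affine m _).comp (measurable_pi_apply k)
  have h1 := integral_map (μ := P) hzm.aemeasurable (hmeas.aestronglyMeasurable)
  rw [map_ensemble_eq hz hlaw hind, integral_map hT.aemeasurable hmeas.aestronglyMeasurable] at h1
  rw [← h1]
  simp only [bilinear_inv_empCov_affine hN1 m _ (transpose_sqrt S)]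
  have h2 : (CFC.sqrt S)⁻¹.mulVec u ⬝ᵥ (CFC.sqrt S)⁻¹.mulVec v = u ⬝ᵥ S⁻¹.mulVec v := by
    rw [← dotProduct_self_mul_mulVec (by rw [Matrix.transpose_nonsing_inv, transpose_sqrt]),
      ← Matrix.mul_inv_rev, sqrt_mul_sqrt hS]
  -- The deviations are taken from the true mean, so there are N degrees of freedom, while the
  -- normalization is N - 1. The factor is therefore (N-1)/(N-1-n) = 1 + n/(N-1-n).
  rw [integral_const_mul, integral_gram_inv_bilinear hc, h2]
  simp only [Fintype.card_fin]
  have h3 : (N : ℝ) - 1 - n ≠ 0 := by linarith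
  have h4 : (N : ℝ) - n - 1 = N - 1 - n := by ring
  rw [h4]
  field_simp
  ring

end Ensemble

/-! ### Freezing the measurable variable in a conditional probability. -/

section Conditioning

/-- If `Y` is `G`-measurable and `Z` is independent of `G`, then the conditional probability of an
event determined by `(Y, Z)` is obtained by freezing `Y`. -/
theorem condProb_ae_eq_of_indep {Ω S T : Type*} (G : MeasurableSpace Ω) [mΩ : MeasurableSpace Ω]
    [MeasurableSpace S] [MeasurableSpace T] {P : Measure Ω} [IsProbabilityMeasure P]
    (hG : G ≤ mΩ) {Y : Ω → S} {Z : Ω → T} (hY : Measurable[G] Y) (hZ : Measurable Z)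
    (hind : Indep (MeasurableSpace.comap Z inferInstance) G P) {A : Set (S × T)}
    (hA : MeasurableSet A) :
    P⟦{ω | (Y ω, Z ω) ∈ A} | G⟧ =ᵐ[P] fun ω => P.real {ω' | (Y ω, Z ω') ∈ A} := by
  have hY' : Measurable Y := hY.mono hG le_rfl
  have : IsProbabilityMeasure (P.map Z) := Measure.isProbabilityMeasure_map hZ.aemeasurable
  have hsec : Measurable fun s : S => P.map Z (Prod.mk s ⁻¹' A) := measurable_measure_prodMk_left hA
  have hreal : ∀ ω, P.real {ω' | (Y ω, Z ω') ∈ A} = (P.map Z (Prod.mk (Y ω) ⁻¹' A)).toReal := by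
    intro ω
    rw [Measure.map_apply hZ (measurable_prodMk_left hA)]
    rfl
  have hGm : Measurable[G] fun ω => P.real {ω' | (Y ω, Z ω') ∈ A} := by
    simp only [hreal]
    exact hsec.ennreal_toReal.comp hY
  have hE : MeasurableSet {ω | (Y ω, Z ω) ∈ A} := (hY'.prodMk hZ) hA
  have hint : Integrable (fun ω => P.real {ω' | (Y ω, Z ω') ∈ A}) P :=
    Integrable.of_bound (hGm.mono hG le_rfl).aestronglyMeasurable 1
      (ae_of_all _ fun ω => by
        rw [Real.norm_of_nonneg measureReal_nonneg]
        exact measureReal_le_one)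
  refine (ae_eq_condExp_of_forall_setIntegral_eq hG ((integrable_const _).indicator hE)
    (fun s _ _ => hint.integrableOn) (fun s hs _ => ?_)
    hGm.stronglyMeasurable.aestronglyMeasurable).symm
  have hs' : MeasurableSet s := hG s hs
  -- Independence from all of `G` makes Y and Z independent even on an event s of `G`; Fubini for
  -- this product law then gives the defining integral identity.
  have hprod : ((P.restrict s).map Y).prod (P.map Z)
      = (P.restrict s).map fun ω => (Y ω, Z ω) := by
    refine Measure.prod_eq fun B C hB hC => ?_
    rw [Measure.map_apply (hY'.prodMk hZ) (hB.prod hC), Measure.map_apply hY' hB,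
      Measure.map_apply hZ hC, Measure.restrict_apply ((hY'.prodMk hZ) (hB.prod hC)),
      Measure.restrict_apply (hY' hB)]
    have h := (Indep_iff _ _ P).1 hind (Z ⁻¹' C) (Y ⁻¹' B ∩ s) ⟨C, hC, rfl⟩ ((hY hB).inter hs)
    rw [mul_comm, ← h]
    congr 1
    ext ω
    simp only [Set.mem_inter_iff, Set.mem_preimage, Set.mem_prod]
    tauto
  rw [integral_indicator_const _ hE, smul_eq_mul, mul_one, measureReal_def]
  simp only [hreal]
  rw [integral_toReal (f := fun ω => P.map Z (Prod.mk (Y ω) ⁻¹' A)) ((hsec.comp hY').aemeasurable) (ae_of_all _ fun ω => measure_lt_top _ _),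
    ← lintegral_map hsec hY', ← Measure.prod_apply hA, hprod,
    Measure.map_apply (hY'.prodMk hZ) hA]
  rfl

end Conditioning

/-! ### Chebyshev bounds for scalars and vectors. -/

section Chebyshev

variable {Ω : Type*} [MeasurableSpace Ω] {P : Measure Ω} [IsProbabilityMeasure P]

theorem one_sub_le_ofReal_measureReal {s t : Set Ω} {b : ℝ≥0∞} (ht : P t ≤ b)
    (hst : sᶜ ⊆ t) : 1 - b ≤ ENNReal.ofReal (P.real s) := by
  rw [ofReal_measureReal, tsub_le_iff_right, ← measure_univ (μ := P), ← Set.union_compl_self s]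
  exact (measure_union_le _ _).trans (add_le_add_right ((measure_mono hst).trans ht) _)

/-- If the error exceeds c, the deviation from the mean exceeds c minus the bias, hence exceeds θ.
-/
theorem one_sub_evariance_div_le {Q : Ω → ℝ} (hQ : AEStronglyMeasurable Q P) {q c θ : ℝ}
    (hθ : 0 < θ) (hc : θ + |∫ ω, Q ω ∂P - q| ≤ c) :
    1 - evariance Q P / ENNReal.ofReal (θ ^ 2) ≤ ENNReal.ofReal (P.real {ω | |q - Q ω| ≤ c}) := by
  have h := meas_ge_le_evariance_div_sq hQ (c := θ.toNNReal) (by simpa using hθ)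
  rw [← ENNReal.ofReal, ← ENNReal.ofReal_pow hθ.le] at h
  refine one_sub_le_ofReal_measureReal h fun ω hω => ?_
  simp only [Set.mem_compl_iff, Set.mem_ofPred_eq, not_le, Real.coe_toNNReal _ hθ.le] at hω ⊢
  have h1 : |q - Q ω| ≤ |Q ω - ∫ ω, Q ω ∂P| + |∫ ω, Q ω ∂P - q| := by
    rw [abs_sub_comm q]
    exact abs_sub_le _ _ _
  linarith

/-- The trace is the sum of n eigenvalues, each at most the supremum of a finite set. Applied to the
covariance matrix, it is the source of the factor n in the gradient bound. -/
theorem trace_le_card_mul_sSup_eigenvalue {n : ℕ} {A : Matrix (Fin n) (Fin n) ℝ}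
    (hA : A.IsHermitian) :
    A.trace ≤ n * sSup {l : ℝ | Module.End.HasEigenvalue (Matrix.toLin' A) l} := by
  have hbdd : BddAbove {l : ℝ | Module.End.HasEigenvalue (Matrix.toLin' A) l} :=
    (Module.End.finite_hasEigenvalue (Matrix.toLin' A)).bddAbove
  have h : ∀ i, hA.eigenvalues i ≤ sSup {l : ℝ | Module.End.HasEigenvalue (Matrix.toLin' A) l} :=
    fun i => le_csSup hbdd <| by
      refine Module.End.hasEigenvalue_of_hasEigenvector (x := (hA.eigenvectorBasis i).ofLp)
        ⟨Module.End.mem_eigenspace_iff.2 ?_, fun h0 => ?_⟩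
      · rw [Matrix.toLin'_apply]
        exact hA.mulVec_eigenvectorBasis i
      · exact (hA.eigenvectorBasis.orthonormal.ne_zero i) (by ext a; exact congrFun h0 a)
  have htr := hA.trace_eq_sum_eigenvalues
  simp only [RCLike.ofReal_real_eq_id, id] at htr
  rw [htr]
  refine (Finset.sum_le_sum fun i _ => h i).trans (le_of_eq ?_)
  simp

/-- Chebyshev's inequality for a random vector, in terms of its covariance matrix. -/
theorem meas_norm_sub_ge_le {n : ℕ} {Y : Ω → E n} (hY : AEStronglyMeasurable Y P) {M : E n}
    (hM : ∀ a, ∫ ω, Y ω a ∂P = M a) {c : ℝ} (hc : 0 < c) :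
    P {ω | c ≤ ‖Y ω - M‖} ≤ n * topCovEigenvalue Y P / ENNReal.ofReal (c ^ 2) := by
  have hc2 : ENNReal.ofReal (c ^ 2) ≠ 0 := by simpa using hc.ne'
  by_cases hL : MemLp Y 2 P
  · have hYa : ∀ a, MemLp (fun ω => Y ω a) 2 P := fun a =>
      hL.continuousLinearMap_comp (EuclideanSpace.proj a : E n →L[ℝ] ℝ)
    set A : Matrix (Fin n) (Fin n) ℝ := Matrix.of fun a b : Fin n =>
      covariance (fun ω => Y ω a) (fun ω => Y ω b) P with hAdef
    have hA : A.IsHermitian := by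
      ext a b
      simp [hAdef, covariance_comm]
    -- The mean squared distance to the mean is the sum of the coordinate variances, so Markov's
    -- inequality applies to the squared norm.
    have hsum : ∫⁻ ω, ENNReal.ofReal (‖Y ω - M‖ ^ 2) ∂P = ENNReal.ofReal A.trace := by
      have h1 : ∀ ω, ENNReal.ofReal (‖Y ω - M‖ ^ 2)
          = ∑ a, ENNReal.ofReal ((Y ω a - ∫ ω, Y ω a ∂P) ^ 2) := fun ω => by
        rw [EuclideanSpace.real_norm_sq_eq, ENNReal.ofReal_sum_of_nonneg fun _ _ => sq_nonneg _]
        simp [hM]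
      simp only [h1]
      rw [lintegral_finsetSum']
      · rw [Matrix.trace, ENNReal.ofReal_sum_of_nonneg]
        · refine Finset.sum_congr rfl fun a _ => ?_
          rw [← evariance_eq_lintegral_ofReal, ← (hYa a).ofReal_variance_eq]
          simp [hAdef, covariance_self (hYa a).aemeasurable]
        · intro a _
          simp only [hAdef, Matrix.diag_apply, Matrix.of_apply]
          rw [covariance_self (hYa a).aemeasurable]
          exact variance_nonneg _ _
      · intro a _
        exact (((hYa a).aemeasurable.sub_const _).pow_const 2).ennreal_ofReal
    have htop : topCovEigenvalue Y P
        = ENNReal.ofReal (sSup {l : ℝ | Module.End.HasEigenvalue (Matrix.toLin' A) l}) := by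
      rw [topCovEigenvalue, if_pos hL]
    have hset : {ω | c ≤ ‖Y ω - M‖} ⊆ {ω | ENNReal.ofReal (c ^ 2) ≤ ENNReal.ofReal (‖Y ω - M‖ ^ 2)} :=
      fun ω hω => ENNReal.ofReal_le_ofReal (pow_le_pow_left₀ hc.le hω 2)
    refine (measure_mono hset).trans ?_
    refine (meas_ge_le_lintegral_div ?_ hc2 ENNReal.ofReal_ne_top).trans ?_
    · exact (((hY.aemeasurable.sub_const M).norm).pow_const 2).ennreal_ofReal
    · gcongr
      rw [hsum, htop, ← ENNReal.ofReal_natCast, ← ENNReal.ofReal_mul (Nat.cast_nonneg n)]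
      exact ENNReal.ofReal_le_ofReal (trace_le_card_mul_sSup_eigenvalue hA)
  -- Without second moments the bound should be infinite, but 0 · ∞ = 0. Dimension zero is excluded
  -- because Y is then constant, hence square integrable.
  · have hn : n ≠ 0 := by
      rintro rfl
      have : Y = fun _ => 0 := funext fun ω => Subsingleton.elim _ _
      exact hL (this ▸ MemLp.zero)
    rw [topCovEigenvalue, if_neg hL, ENNReal.mul_top (by exact_mod_cast hn),
      ENNReal.top_div_of_ne_top ENNReal.ofReal_ne_top]
    exact le_top

end Chebyshev

/-! ### Cancellation of the observation terms. -/

section Gradient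

variable {n d : ℕ}

theorem wnormSq_eq_inner (A : Matrix (Fin n) (Fin n) ℝ) (v : E n) :
    wnormSq A v = inner ℝ v (Matrix.toEuclideanCLM (𝕜 := ℝ) A v) := by
  rw [Matrix.inner_toEuclideanCLM]
  simp [wnormSq]

theorem toEuclideanCLM_eq_matVec (A : Matrix (Fin n) (Fin n) ℝ) (v : E n) :
    Matrix.toEuclideanCLM (𝕜 := ℝ) A v = matVec A v := rfl

theorem differentiable_wnormSq (A : Matrix (Fin n) (Fin n) ℝ) : Differentiable ℝ (wnormSq A) := by
  have h : wnormSq A = fun v => inner ℝ v (Matrix.toEuclideanCLM (𝕜 := ℝ) A v) :=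
    funext (wnormSq_eq_inner A)
  rw [h]
  exact differentiable_id.inner ℝ (Matrix.toEuclideanCLM (𝕜 := ℝ) A).differentiable

theorem hasFDerivAt_half_wnormSq {A : Matrix (Fin n) (Fin n) ℝ} (hA : A.transpose = A) (v : E n) :
    HasFDerivAt (fun v => 1 / 2 * wnormSq A v) (InnerProductSpace.toDual ℝ (E n) (matVec A v)) v := by
  have h : (fun v => 1 / 2 * wnormSq A v)
      = fun v => 1 / 2 * inner ℝ v (Matrix.toEuclideanCLM (𝕜 := ℝ) A v) :=
    funext fun v => by rw [wnormSq_eq_inner]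
  rw [h]
  have h1 := ((hasFDerivAt_id v).inner ℝ
    ((Matrix.toEuclideanCLM (𝕜 := ℝ) A).hasFDerivAt (x := v))).const_mul (1 / 2 : ℝ)
  refine h1.congr_fderiv ?_
  ext w
  have h2 : inner ℝ v (Matrix.toEuclideanCLM (𝕜 := ℝ) A w)
      = inner ℝ w (Matrix.toEuclideanCLM (𝕜 := ℝ) A v) := by
    rw [Matrix.inner_toEuclideanCLM, Matrix.inner_toEuclideanCLM]
    rw [Matrix.dotProduct_mulVec, ← Matrix.mulVec_transpose, hA, dotProduct_comm]
  have h3 : inner ℝ (matVec A v) w = inner ℝ w (Matrix.toEuclideanCLM (𝕜 := ℝ) A v) := by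
    rw [real_inner_comm, toEuclideanCLM_eq_matVec]
  simp only [smul_apply, ContinuousLinearMap.comp_apply,
    ContinuousLinearMap.prod_apply, fderivInnerCLM_apply, ContinuousLinearMap.id_apply, id,
    InnerProductSpace.toDual_apply_apply, smul_eq_mul]
  rw [h2, h3]
  ring

namespace Problem

variable (D : Problem n d)

theorem gradient_f_sub_modelGrad {C : Matrix (Fin n) (Fin n) ℝ} (hC : C.transpose = C) (x : E n) :
    gradient D.f x - D.modelGrad C x
      = matVec D.Binf⁻¹ (x - D.zb) - matVec C⁻¹ (x - D.zb) := by
  have hB : (D.Binf⁻¹).transpose = D.Binf⁻¹ := by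
    have h := D.Binf_posDef.isHermitian
    rw [Matrix.IsHermitian, Matrix.conjTranspose_eq_transpose_of_trivial] at h
    rw [Matrix.transpose_nonsing_inv, h]
  have hCi : (C⁻¹).transpose = C⁻¹ := by rw [Matrix.transpose_nonsing_inv, hC]
  have hq : Differentiable ℝ fun p : E d => 1 / 2 * wnormSq D.R⁻¹ p :=
    (differentiable_wnormSq _).const_mul _
  have hH : HasFDerivAt D.H (fderiv ℝ D.H x) x :=
    (D.H_contDiff.differentiable one_ne_zero x).hasFDerivAt
  -- The common derivative of both observation terms: at step 0 the linearized residual agrees with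
  -- the true one to first order.
  set K := (fderiv ℝ (fun p : E d => 1 / 2 * wnormSq D.R⁻¹ p) (D.y - D.H x)).comp
    (-(fderiv ℝ D.H x)) with hK
  have hobs : HasFDerivAt (fun x => 1 / 2 * wnormSq D.R⁻¹ (D.y - D.H x)) K x :=
    HasFDerivAt.comp (g := fun p : E d => 1 / 2 * wnormSq D.R⁻¹ p) x (hq (D.y - D.H x)).hasFDerivAt
      (hH.const_sub D.y)
  have hobs' : HasFDerivAt
      (fun s => 1 / 2 * wnormSq D.R⁻¹ (D.y - D.H x - fderiv ℝ D.H x s)) K 0 := by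
    have h0 : D.y - D.H x - fderiv ℝ D.H x 0 = D.y - D.H x := by simp
    have h1 := (hq (D.y - D.H x - fderiv ℝ D.H x 0)).hasFDerivAt.comp (0 : E n)
      ((fderiv ℝ D.H x).hasFDerivAt.const_sub (D.y - D.H x))
    rw [h0] at h1
    exact h1
  have hf : HasFDerivAt D.f
      (InnerProductSpace.toDual ℝ (E n) (matVec D.Binf⁻¹ (x - D.zb)) + K) x := by
    have h1 : HasFDerivAt (fun x : E n => x - D.zb) (ContinuousLinearMap.id ℝ (E n)) x :=
      (hasFDerivAt_id x).sub_const D.zb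
    have h2 := (hasFDerivAt_half_wnormSq hB (x - D.zb)).comp x h1
    exact (h2.add hobs).congr_of_eventuallyEq (Filter.Eventually.of_forall fun s => rfl)
  have hm : HasFDerivAt (D.model C 0 x)
      (InnerProductSpace.toDual ℝ (E n) (matVec C⁻¹ (x - D.zb)) + K) 0 := by
    have h1 : HasFDerivAt (fun s : E n => s + x - D.zb) (ContinuousLinearMap.id ℝ (E n)) 0 :=
      ((hasFDerivAt_id (0 : E n)).add_const x).sub_const D.zb
    have h0 : (0 : E n) + x - D.zb = x - D.zb := by rw [zero_add]
    have h2 := (hasFDerivAt_half_wnormSq hCi ((0 : E n) + x - D.zb)).comp (0 : E n) h1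
    rw [h0] at h2
    refine (h2.add hobs').congr_of_eventuallyEq (Filter.Eventually.of_forall fun s => ?_)
    simp [Problem.model]
  rw [Problem.modelGrad, gradient, gradient, hf.fderiv, hm.fderiv, map_add, map_add,
    LinearIsometryEquiv.symm_apply_apply, LinearIsometryEquiv.symm_apply_apply,
    add_sub_add_right_eq_sub]

theorem f_sub_cost (C : Matrix (Fin n) (Fin n) ℝ) (x : E n) :
    D.f x - D.cost C x
      = 1 / 2 * (wnormSq D.Binf⁻¹ (x - D.zb) - wnormSq C⁻¹ (x - D.zb)) := by
  rw [Problem.f, Problem.cost, Problem.cost]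
  ring

theorem model_zero (C : Matrix (Fin n) (Fin n) ℝ) (γ : ℝ) (x : E n) :
    D.model C γ x 0 = D.cost C x := by
  simp [Problem.model, Problem.cost]

end Problem

theorem transpose_empCov {N : ℕ} (m : E n) (z : Fin N → E n) :
    (empCov m z).transpose = empCov m z := by
  rw [empCov, Matrix.transpose_smul, Matrix.transpose_sum]
  simp only [Matrix.transpose_vecMulVec]

end Gradient

/-! ### Positivity of the gap from the ensemble size. -/

theorem wnormSq_inv_nonneg {n : ℕ} {A : Matrix (Fin n) (Fin n) ℝ} (hA : A.PosDef) (v : E n) :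
    0 ≤ wnormSq A⁻¹ v := by
  have := hA.inv.posSemidef.dotProduct_mulVec_nonneg v.ofLp
  rwa [star_trivial] at this

/-- The size condition says aμ²n < N - 1 - n, and q ≤ abμ² turns this into nq < b(N - 1 - n).
Nonnegativity of a also yields N > n + 1, the range in which the inverse has the computed mean. -/
theorem gap_pos {a b μ q : ℝ} {n N : ℕ} (ha : 0 ≤ a) (hb : 0 < b) (hq : q ≤ a * (b * μ ^ 2))
    (h : (a * μ ^ 2 + 1) * n + 1 < (N : ℝ)) :
    (n : ℝ) + 1 < N ∧ 0 < b - (n : ℝ) / ((N : ℝ) - 1 - n) * q := by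
  have hn : (0 : ℝ) ≤ n := Nat.cast_nonneg n
  have h1 : 0 ≤ a * μ ^ 2 * n := by positivity
  have hN : (n : ℝ) + 1 < N := by linarith
  refine ⟨hN, ?_⟩
  have hK : 0 < (N : ℝ) - 1 - n := by linarith
  rw [sub_pos, div_mul_eq_mul_div, div_lt_iff₀ hK]
  have h2 : n * q ≤ n * (a * (b * μ ^ 2)) := mul_le_mul_of_nonneg_left hq hn
  have h3 : b * (a * μ ^ 2 * n) < b * ((N : ℝ) - 1 - n) := mul_lt_mul_of_pos_left (by linarith) hb
  linarith

/-! ### Bounds along the run, at fixed and at random points. -/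

namespace Run

variable {n d : ℕ} {D : Problem n d} {c : Params} {N : ℕ} {Ω : Type*} {G : MeasurableSpace Ω}
  [mΩ : MeasurableSpace Ω] {P : Measure Ω} (r : Run D c N P)

theorem u_bounds (i : ℕ) (ω : Ω) : c.muMin ≤ r.u i ω ∧ r.u i ω ≤ c.lam ^ i * c.mu0 := by
  have hmin := c.muMin_pos
  have hlam := c.one_lt_lam
  induction i with
  | zero => simp [r.u_zero, c.muMin_le_mu0]
  | succ i ih =>
    obtain ⟨h1, h2⟩ := ih
    have h3 : r.u i ω ≤ c.lam * r.u i ω := le_mul_of_one_le_left (hmin.le.trans h1) hlam.le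
    have h4 : c.lam * r.u i ω ≤ c.lam ^ (i + 1) * c.mu0 := by
      rw [pow_succ', mul_assoc]
      exact mul_le_mul_of_nonneg_left h2 (by linarith)
    have hstep : r.u (i + 1) ω = max (r.u i ω / c.lam) c.muMin ∨ r.u (i + 1) ω = c.lam * r.u i ω :=
      (Classical.em _).elim (fun hs => .inl (r.success i ω hs).2)
        fun hs => .inr (r.failure i ω hs).2
    rcases hstep with h | h
    · rw [h]
      refine ⟨le_max_right _ _, max_le ?_ ?_⟩
      · exact (div_le_self (hmin.le.trans h1) hlam.le).trans (h3.trans h4)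
      · exact h1.trans (h3.trans h4)
    · rw [h]
      exact ⟨h1.trans h3, h4⟩

theorem u_pos (i : ℕ) (ω : Ω) : 0 < r.u i ω := c.muMin_pos.trans_le (r.u_bounds i ω).1

theorem u_le_muBar {i : ℕ} {ω : Ω} (h : r.u i ω ≤ c.muMax) : r.u i ω ≤ c.muBar i :=
  le_min (r.u_bounds i ω).2 h

theorem measurable_X_of_history {j : ℕ} (h : r.history j ≤ G) :
    Measurable[G] (r.X j) := by
  refine measurable_iff_comap_le.2 (le_trans ?_ h)
  exact le_sup_of_le_left (le_sup_left.trans (le_iSup (fun i : Fin (j + 1) =>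
    MeasurableSpace.comap (r.X i) inferInstance ⊔ MeasurableSpace.comap (r.u i) inferInstance)
    (Fin.last j)))

theorem measurable_u_of_history {j : ℕ} (h : r.history j ≤ G) :
    Measurable[G] (r.u j) := by
  refine measurable_iff_comap_le.2 (le_trans ?_ h)
  exact le_sup_of_le_left (le_sup_right.trans (le_iSup (fun i : Fin (j + 1) =>
    MeasurableSpace.comap (r.X i) inferInstance ⊔ MeasurableSpace.comap (r.u i) inferInstance)
    (Fin.last j)))

theorem measurable_ensemble (j : ℕ) : Measurable fun ω k => r.z j k ω :=
  measurable_pi_lambda _ fun k => r.z_measurable j k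

theorem measurable_inv_B_apply (j : ℕ) (a b : Fin n) : Measurable fun ω => (r.B j ω)⁻¹ a b :=
  (measurable_inv_empCov_apply D.zb a b).comp (r.measurable_ensemble j)

theorem integral_bilinear_inv_B [IsProbabilityMeasure P] (hN : (n : ℝ) + 1 < N) (j : ℕ)
    (u v : Fin n → ℝ) :
    ∫ ω, u ⬝ᵥ (r.B j ω)⁻¹.mulVec v ∂P
      = (1 + (n : ℝ) / ((N : ℝ) - 1 - n)) * (u ⬝ᵥ D.Binf⁻¹.mulVec v) :=
  integral_bilinear_inv_empCov D.Binf_posDef (r.z_measurable j) (r.z_law j) (r.z_indep j) hN u v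

/-- At a fixed point, the exact cost and its estimate are close with high probability. -/
theorem one_sub_varNormSq_div_le [IsProbabilityMeasure P] (hN : (n : ℝ) + 1 < N) (j : ℕ) (x : E n)
    {κ t μ : ℝ} (hκ : 0 < κ) (ht : 0 < t) (htμ : t ≤ μ) (hgap : 0 < thetaGap D N μ κ x) :
    1 - r.varNormSq j x / ENNReal.ofReal (thetaGap D N μ κ x ^ 2)
      ≤ ENNReal.ofReal (P.real {ω | |D.f x - D.cost (r.B j ω) x| ≤ κ / t ^ 2}) := by
  have hset : {ω | |D.f x - D.cost (r.B j ω) x| ≤ κ / t ^ 2}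
      = {ω | |wnormSq D.Binf⁻¹ (x - D.zb) - wnormSq (r.B j ω)⁻¹ (x - D.zb)| ≤ 2 * κ / t ^ 2} := by
    ext ω
    simp only [Set.mem_ofPred_eq, D.f_sub_cost, abs_mul]
    rw [abs_of_pos (by norm_num : (0 : ℝ) < 1 / 2), mul_div_assoc]
    constructor <;> intro h <;> linarith
  rw [hset]
  refine one_sub_evariance_div_le (Q := fun ω => wnormSq (r.B j ω)⁻¹ (x - D.zb)) (measurable_dotProduct_mulVec (r.measurable_inv_B_apply j)
    _ _).aestronglyMeasurable hgap ?_
  have hint : ∫ ω, wnormSq (r.B j ω)⁻¹ (x - D.zb) ∂P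
      = (1 + (n : ℝ) / ((N : ℝ) - 1 - n)) * wnormSq D.Binf⁻¹ (x - D.zb) :=
    r.integral_bilinear_inv_B hN j _ _
  have hρ : 0 ≤ (n : ℝ) / ((N : ℝ) - 1 - n) := div_nonneg (Nat.cast_nonneg n) (by linarith)
  have hq := wnormSq_inv_nonneg D.Binf_posDef (x - D.zb)
  -- The tolerance uses the actual parameter t, the gap its upper bound μ; since t ≤ μ, the gap plus
  -- the bias stays within the tolerance.
  have h1 : 2 * κ / μ ^ 2 ≤ 2 * κ / t ^ 2 := by gcongr
  rw [hint, add_mul, one_mul, add_sub_cancel_left, abs_of_nonneg (mul_nonneg hρ hq), thetaGap]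
  linarith

/-- At a fixed point, the exact gradient and the model gradient are close with high
probability. -/
theorem one_sub_lambdaMax_div_le [IsProbabilityMeasure P] (hN : (n : ℝ) + 1 < N) (j : ℕ) (x : E n)
    {κ t μ : ℝ} (hκ : 0 < κ) (ht : 0 < t) (htμ : t ≤ μ) (hgap : 0 < upsilonGap D N μ κ x) :
    1 - n * r.lambdaMax j x / ENNReal.ofReal (upsilonGap D N μ κ x ^ 2)
      ≤ ENNReal.ofReal (P.real {ω | ‖matVec D.Binf⁻¹ (x - D.zb)
        - matVec (r.B j ω)⁻¹ (x - D.zb)‖ ≤ κ / t}) := by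
  set ρ : ℝ := (n : ℝ) / ((N : ℝ) - 1 - n) with hρdef
  have hρ : 0 ≤ ρ := div_nonneg (Nat.cast_nonneg n) (by linarith)
  set g := matVec D.Binf⁻¹ (x - D.zb) with hg
  have hcoord : ∀ (A : Matrix (Fin n) (Fin n) ℝ) (v : E n) (a : Fin n),
      matVec A v a = Pi.single a (1 : ℝ) ⬝ᵥ A.mulVec v.ofLp := fun A v a => by
    rw [single_one_dotProduct]
    rfl
  have hY : Measurable fun ω => matVec (r.B j ω)⁻¹ (x - D.zb) := by
    have h : Measurable fun ω => (r.B j ω)⁻¹.mulVec (x - D.zb).ofLp :=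
      measurable_pi_lambda _ fun a => Finset.measurable_sum Finset.univ
        (f := fun b ω => (r.B j ω)⁻¹ a b * (x - D.zb).ofLp b) fun b _ =>
        (r.measurable_inv_B_apply j a b).mul_const _
    exact (WithLp.measurable_toLp 2 _).comp h
  have hM : ∀ a, ∫ ω, matVec (r.B j ω)⁻¹ (x - D.zb) a ∂P = ((1 + ρ) • g) a := fun a => by
    simp only [hcoord]
    rw [r.integral_bilinear_inv_B hN j, ← hcoord]
    rfl
  refine one_sub_le_ofReal_measureReal (meas_norm_sub_ge_le hY.aestronglyMeasurable hM hgap)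
    fun ω hω => ?_
  simp only [Set.mem_compl_iff, Set.mem_ofPred_eq, not_le] at hω ⊢
  have h1 : ‖g - matVec (r.B j ω)⁻¹ (x - D.zb)‖
      ≤ ‖matVec (r.B j ω)⁻¹ (x - D.zb) - (1 + ρ) • g‖ + ρ * ‖g‖ := by
    -- The mean is (1 + ρ)g, so the error splits into the centred fluctuation and the bias ρg.
    have h2 : g - matVec (r.B j ω)⁻¹ (x - D.zb)
        = -(matVec (r.B j ω)⁻¹ (x - D.zb) - (1 + ρ) • g) - ρ • g := by
      rw [add_smul, one_smul]
      abel
    rw [h2]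
    refine (norm_sub_le _ _).trans (le_of_eq ?_)
    rw [norm_neg, norm_smul, Real.norm_of_nonneg hρ]
  have h3 : κ / μ ≤ κ / t := by gcongr
  rw [upsilonGap, ← hρdef, ← hg]
  linarith

/-- The fixed-point bound evaluated at W ω after conditioning. A general `G`-measurable W serves
both the iterate and the trial point. -/
theorem ae_one_sub_varNormSq_div_le [IsProbabilityMeasure P] (hG : G ≤ mΩ)
    {j : ℕ} (hhist : r.history j ≤ G) (hindep : Indep (r.ensembleSigma j) G P) {W : Ω → E n}
    (hW : Measurable[G] W) {κ : ℝ} (hκ : 0 < κ) :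
    ∀ᵐ ω ∂P, r.u j ω ≤ c.muMax → (n : ℝ) + 1 < N → 0 < thetaGap D N (c.muBar j) κ (W ω) →
      1 - r.varNormSq j (W ω) / ENNReal.ofReal (thetaGap D N (c.muBar j) κ (W ω) ^ 2)
        ≤ ENNReal.ofReal
          ((P⟦{ω' | |D.f (W ω') - D.cost (r.B j ω') (W ω')| ≤ κ / r.u j ω' ^ 2} | G⟧) ω) := by
  have hA : MeasurableSet {p : (E n × ℝ) × (Fin N → E n) |
      |D.f p.1.1 - D.cost (empCov D.zb p.2) p.1.1| ≤ κ / p.1.2 ^ 2} := by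
    have hq : ∀ M : (Fin N → E n) → Matrix (Fin n) (Fin n) ℝ,
        (∀ a b, Measurable fun z => M z a b) → Measurable fun p : (E n × ℝ) × (Fin N → E n) =>
          wnormSq (M p.2) (p.1.1 - D.zb) := fun M hM => by
      simp only [wnormSq, dotProduct_mulVec_eq_sum]
      refine Finset.measurable_sum _ fun a _ => Finset.measurable_sum _ fun b _ => ?_
      have := (hM a b).comp (measurable_snd : Measurable (Prod.snd : (E n × ℝ) × _ → _))
      refine Measurable.mul ?_ this
      fun_prop
    simp only [D.f_sub_cost]
    refine measurableSet_le ?_ (by fun_prop)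
    have h1 := hq (fun _ => D.Binf⁻¹) fun a b => measurable_const
    have h2 := hq (fun z => (empCov D.zb z)⁻¹) fun a b => measurable_inv_empCov_apply D.zb a b
    exact ((h1.sub h2).const_mul _).abs
  have h := condProb_ae_eq_of_indep G hG
    (hW.prodMk (r.measurable_u_of_history hhist)) (r.measurable_ensemble j) hindep hA
  filter_upwards [h] with ω hω hu hN hgap
  refine (r.one_sub_varNormSq_div_le hN j (W ω) hκ (r.u_pos j ω) (r.u_le_muBar hu) hgap).trans ?_
  exact (congrArg ENNReal.ofReal hω).ge

theorem ae_one_sub_lambdaMax_div_le [IsProbabilityMeasure P] (hG : G ≤ mΩ)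
    {j : ℕ} (hhist : r.history j ≤ G) (hindep : Indep (r.ensembleSigma j) G P)
    {κ : ℝ} (hκ : 0 < κ) :
    ∀ᵐ ω ∂P, r.u j ω ≤ c.muMax → (n : ℝ) + 1 < N → 0 < upsilonGap D N (c.muBar j) κ (r.X j ω) →
      1 - n * r.lambdaMax j (r.X j ω)
          / ENNReal.ofReal (upsilonGap D N (c.muBar j) κ (r.X j ω) ^ 2)
        ≤ ENNReal.ofReal
          ((P⟦{ω' | ‖gradient D.f (r.X j ω') - gradient (r.model j ω') 0‖
            ≤ κ / r.u j ω'} | G⟧) ω) := by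
  have hset : {ω' | ‖gradient D.f (r.X j ω') - gradient (r.model j ω') 0‖ ≤ κ / r.u j ω'}
      = {ω' | ‖matVec D.Binf⁻¹ (r.X j ω' - D.zb) - matVec (r.B j ω')⁻¹ (r.X j ω' - D.zb)‖
          ≤ κ / r.u j ω'} := by
    ext ω'
    have h1 : gradient (r.model j ω') 0 = D.modelGrad (r.B j ω') (r.X j ω') :=
      D.gradient_model_zero _ _ _
    rw [Set.mem_ofPred_eq, Set.mem_ofPred_eq, h1,
      D.gradient_f_sub_modelGrad (C := r.B j ω') (transpose_empCov _ _)]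
  have hA : MeasurableSet {p : (E n × ℝ) × (Fin N → E n) |
      ‖matVec D.Binf⁻¹ (p.1.1 - D.zb) - matVec (empCov D.zb p.2)⁻¹ (p.1.1 - D.zb)‖
        ≤ κ / p.1.2} := by
    have hq : ∀ M : (Fin N → E n) → Matrix (Fin n) (Fin n) ℝ,
        (∀ a b, Measurable fun z => M z a b) → Measurable fun p : (E n × ℝ) × (Fin N → E n) =>
          matVec (M p.2) (p.1.1 - D.zb) := fun M hM => by
      refine (WithLp.measurable_toLp 2 _).comp (measurable_pi_lambda _ fun a =>
        Finset.measurable_sum Finset.univ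
          (f := fun b (p : (E n × ℝ) × (Fin N → E n)) => M p.2 a b * (p.1.1 - D.zb).ofLp b) fun b _ => ?_)
      have := (hM a b).comp (measurable_snd : Measurable (Prod.snd : (E n × ℝ) × _ → _))
      refine Measurable.mul this ?_
      fun_prop
    have h1 := hq (fun _ => D.Binf⁻¹) fun a b => measurable_const
    have h2 := hq (fun z => (empCov D.zb z)⁻¹) fun a b => measurable_inv_empCov_apply D.zb a b
    exact measurableSet_le (h1.sub h2).norm (by fun_prop)
  have h := condProb_ae_eq_of_indep G hG
    ((r.measurable_X_of_history hhist).prodMk (r.measurable_u_of_history hhist))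
    (r.measurable_ensemble j) hindep hA
  rw [hset]
  filter_upwards [h] with ω hω hu hN hgap
  refine (r.one_sub_lambdaMax_div_le hN j (r.X j ω) hκ (r.u_pos j ω) (r.u_le_muBar hu) hgap).trans
    ?_
  exact (congrArg ENNReal.ofReal hω).ge

end Run

/-! ### The threshold dominates each of the required ratios. -/

section Aleph

variable {n d : ℕ} (D : Problem n d) {N : ℕ} {μ εf κef κeg : ℝ} {x s : E n}

theorem aleph_nonneg (hεf : 0 < εf) : 0 ≤ aleph D μ εf κef κeg x s :=
  le_trans (div_nonneg (wnormSq_inv_nonneg D.Binf_posDef _) (by positivity))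
    ((le_max_left _ _).trans (le_max_left _ _))

theorem thetaGap_pos_of_aleph (hμ : 0 < μ) (hεf : 0 < εf) {κ : ℝ} (hκ : 0 < κ) {w : E n}
    (hw : wnormSq D.Binf⁻¹ (w - D.zb) / (2 * κ) ≤ aleph D μ εf κef κeg x s)
    (h : (aleph D μ εf κef κeg x s * μ ^ 2 + 1) * n + 1 < (N : ℝ)) :
    (n : ℝ) + 1 < N ∧ 0 < thetaGap D N μ κ w := by
  refine gap_pos (aleph_nonneg D hεf) (by positivity) ?_ h
  rw [div_mul_cancel₀ _ (by positivity)]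
  exact (div_le_iff₀ (by positivity)).1 hw

theorem upsilonGap_pos_of_aleph (hμ : 0 < μ) (hεf : 0 < εf) (hκ : 0 < κeg)
    (h : (aleph D μ εf κef κeg x s * μ ^ 2 + 1) * n + 1 < (N : ℝ)) :
    (n : ℝ) + 1 < N ∧ 0 < upsilonGap D N μ κeg x := by
  refine gap_pos (aleph_nonneg D hεf) (by positivity) ?_ h
  have h1 : κeg / μ * μ ^ 2 = κeg * μ := by field_simp
  rw [h1]
  exact (div_le_iff₀ (by positivity)).1 ((le_max_right _ _).trans (le_max_right _ _))

end Aleph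

end DataAssim

theorem theorem6p2 {n d N : ℕ} {Ω : Type*} (G : MeasurableSpace Ω) [mΩ : MeasurableSpace Ω]
    (P : Measure Ω) [IsProbabilityMeasure P]
    (D : DataAssim.Problem n d) (c : DataAssim.Params) (r : DataAssim.Run D c N P)
    (εf κef κeg : ℝ) (hεf : 0 < εf) (hκef : 0 < κef) (hκeg : 0 < κeg)
    (j : ℕ) (hG : G ≤ mΩ) (hhist : r.history j ≤ G)
    (hindep : Indep (r.ensembleSigma j) G P) :
    (∀ᵐ ω ∂P, r.u j ω ≤ c.muMax →
      (DataAssim.aleph D (c.muBar j) εf κef κeg (r.X j ω) (r.S j ω) * c.muBar j ^ 2 + 1) * n + 1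
        < (N : ℝ) →
      1 - r.varNormSq j (r.X j ω)
          / ENNReal.ofReal (DataAssim.thetaGap D N (c.muBar j) εf (r.X j ω) ^ 2)
        ≤ ENNReal.ofReal
            ((P⟦{ω' | |D.f (r.X j ω') - r.F0 j ω'| ≤ εf / r.u j ω' ^ 2} | G⟧) ω)) ∧
    (Measurable[G] (r.S j) → ∀ᵐ ω ∂P, r.u j ω ≤ c.muMax →
      (DataAssim.aleph D (c.muBar j) εf κef κeg (r.X j ω) (r.S j ω) * c.muBar j ^ 2 + 1) * n + 1
        < (N : ℝ) →
      1 - r.varNormSq j (r.X j ω + r.S j ω)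
          / ENNReal.ofReal (DataAssim.thetaGap D N (c.muBar j) εf (r.X j ω + r.S j ω) ^ 2)
        ≤ ENNReal.ofReal
            ((P⟦{ω' | |D.f (r.X j ω' + r.S j ω') - r.F1 j ω'| ≤ εf / r.u j ω' ^ 2} | G⟧) ω)) ∧
    (∀ᵐ ω ∂P, r.u j ω ≤ c.muMax →
      (DataAssim.aleph D (c.muBar j) εf κef κeg (r.X j ω) (r.S j ω) * c.muBar j ^ 2 + 1) * n + 1
        < (N : ℝ) →
      1 - r.varNormSq j (r.X j ω)
          / ENNReal.ofReal (DataAssim.thetaGap D N (c.muBar j) κef (r.X j ω) ^ 2)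
        ≤ ENNReal.ofReal
            ((P⟦{ω' | |D.f (r.X j ω') - r.model j ω' 0| ≤ κef / r.u j ω' ^ 2} | G⟧) ω)) ∧
    (∀ᵐ ω ∂P, r.u j ω ≤ c.muMax →
      (DataAssim.aleph D (c.muBar j) εf κef κeg (r.X j ω) (r.S j ω) * c.muBar j ^ 2 + 1) * n + 1
        < (N : ℝ) →
      1 - n * r.lambdaMax j (r.X j ω)
          / ENNReal.ofReal (DataAssim.upsilonGap D N (c.muBar j) κeg (r.X j ω) ^ 2)
        ≤ ENNReal.ofReal
            ((P⟦{ω' | ‖gradient D.f (r.X j ω') - gradient (r.model j ω') 0‖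
              ≤ κeg / r.u j ω'} | G⟧) ω)) := by
  have hμ : ∀ ω, r.u j ω ≤ c.muMax → 0 < c.muBar j := fun ω hu =>
    (r.u_pos j ω).trans_le (r.u_le_muBar hu)
  have hX := r.measurable_X_of_history hhist
  refine ⟨?_, fun hS => ?_, ?_, ?_⟩
  · filter_upwards [r.ae_one_sub_varNormSq_div_le hG hhist hindep hX hεf] with ω hω hu hN
    obtain ⟨h1, h2⟩ := DataAssim.thetaGap_pos_of_aleph D (hμ ω hu) hεf hεf
      ((le_max_left _ _).trans (le_max_left _ _)) hN
    exact hω hu h1 h2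
  · filter_upwards [r.ae_one_sub_varNormSq_div_le hG hhist hindep
      (W := fun ω => r.X j ω + r.S j ω) (hX.add hS) hεf] with ω hω hu hN
    obtain ⟨h1, h2⟩ := DataAssim.thetaGap_pos_of_aleph D (hμ ω hu) hεf hεf
      ((le_max_right _ _).trans (le_max_left _ _)) hN
    exact hω hu h1 h2
  -- The model at step 0 equals the estimated cost, so the third bound is the first with another
  -- tolerance.
  · have hset : {ω' | |D.f (r.X j ω') - r.model j ω' 0| ≤ κef / r.u j ω' ^ 2}
        = {ω' | |D.f (r.X j ω') - D.cost (r.B j ω') (r.X j ω')| ≤ κef / r.u j ω' ^ 2} := by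
      simp only [DataAssim.Run.model, D.model_zero]
    rw [hset]
    filter_upwards [r.ae_one_sub_varNormSq_div_le hG hhist hindep hX hκef] with ω hω hu hN
    obtain ⟨h1, h2⟩ := DataAssim.thetaGap_pos_of_aleph D (hμ ω hu) hεf hκef
      ((le_max_left _ _).trans (le_max_right _ _)) hN
    exact hω hu h1 h2
  · filter_upwards [r.ae_one_sub_lambdaMax_div_le hG hhist hindep hκeg] with ω hω hu hN
    obtain ⟨h1, h2⟩ := DataAssim.upsilonGap_pos_of_aleph D (hμ ω hu) hεf hκeg hN
    exact hω hu h1 h2
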